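/- **Setting.** Let $I$ (online vertex types) and $J$ (offline vertices) be finite sets, $E\subseteq I\times J$ the edge set of the type graph, $J_i=\{j:(i,j)\in E\}$ and $I_j=\{i:(i,j)\in E\}$. Each type $i$ has an arrival rate $\lambda_i>0$ and each edge $(i,j)\in E$ a weight $w_{ij}>0$. Online vertices of type $i$ arrive during $[0,1]$ according to a Poisson process of rate $\lambda_i$, independently for different types. On arrival, an online vertex is irrevocably matched to at most one offline neighbor. With free disposal, an offline vertex may be matched several times, but only the heaviest edge matched to it counts; the objective is the sum over $j\in J$ of the weight of the heaviest edge matched to $j$ ($0$ if $j$ is unmatched). **Natural LP.** Let $(x_{ij})_{(i,j)\in E}$ be an optimal solution of: maximize $\sum_{(i,j)\in E}w_{ij}x_{ij}$ subject to $x_{ij}\ge 0$ for $(i,j)\in E$, $\sum_{j\in J_i}x_{ij}\le\lambda_i$ for $i\in I$, and $\sum_{i\in S}x_{ij}\le 1-\exp\bigl(-\sum_{i\in S}\lambda_i\bigr)$ for $j\in J$ and $S\subseteq I_j$. **Algorithm (Regularized Greedy).** Write $z^+=\max\{z,0\}$ and $p(\rho)=\min\{2\rho,1\}$, and for $0\le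 t\le 1$ let $$\alpha(t)=1-\frac{(2e)^t}{e(1-\ln 2)}+\frac{(1+\ln 2)\,e^{2t}}{e^2(1-\ln 2)},\qquad \beta(t)=\frac{(2e)^t}{2e(1-\ln 2)}-\frac{e^{2t}}{e^2(1-\ln 2)}.$$ Let $w_j(t)$ be the maximum weight of an edge matched to $j$ before time $t$ ($0$ if there is none), and $w_{ij}(t)=(w_{ij}-w_j(t))^+$. For $v\ge 0$ let $\rho_{ij}(t,v)=x_{ij}/\lambda_i$ if $v\le w_{ij}(t)$ and $\rho_{ij}(t,v)=0$ otherwise, and $\rho_i(t,v)=\sum_{j\in J_i}\rho_{ij}(t,v)$. Define $$r_{ij}(t)=\alpha(t)\sum_{i'\in I_j}\Bigl(w_{i'j}(t)-\bigl(w_{i'j}(t)-w_{ij}(t)\bigr)^+\Bigr)x_{i'j}+\beta(t)\sum_{i'\in I_j}\int_{(w_{i'j}(t)-w_{ij}(t))^+}^{w_{i'j}(t)}\lambda_{i'}\Bigl(p\bigl(\rho_{i'}(t,v)\bigr)-p\bigl(\rho_{i'}(t,v)-\rho_{i'j}(t,v)\bigr)\Bigr)\,dv .$$ An online vertex of type $i$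 arriving at time $t$ is matched to a neighbor $j\in J_i$ that maximizes $w_{ij}(t)-r_{ij}(t)$ (it stays unmatched if $J_i=\emptyset$). Ties are broken by any fixed rule depending measurably on $t$, and on $i$ and $(w_j(t))_{j\in J}$; for instance, by a fixed order on $J$. **Theorem.** For every instance of edge-weighted online stochastic matching with free disposal, Regularized Greedy is $0.706$-competitive: if $\mathrm{ALG}$ is the objective it attains and $\mathrm{OPT}$ the best objective attainable in hindsight on the realized arrivals, then both have finite expectation and $$\mathbb{E}[\mathrm{ALG}]\ \ge\ 0.706\cdot\mathbb{E}[\mathrm{OPT}].$$ -/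

import Mathlib

open MeasureTheory ProbabilityTheory Set

noncomputable section

namespace StochMatching

/-- An instance of edge-weighted online stochastic matching: online vertex types `I`, offline
vertices `J`, the edges `E` of the type graph, the Poisson arrival rate of each online type, and
a weight for each edge. Values `w i j` with `(i, j) ∉ E` are never used. -/
structure MatchingInstance (I J : Type*) where
  E : Finset (I × J)
  rate : I → ℝ
  rate_pos : ∀ i, 0 < rate i
  w : I → J → ℝ
  w_pos : ∀ i j, (i, j) ∈ E → 0 < w i j

section Algorithm

variable {I J : Type*} [Fintype I] [DecidableEq I] [Fintype J] [DecidableEq J]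

/-- The neighborhood `J_i` of an online type `i`. -/
def MatchingInstance.nbrJ (G : MatchingInstance I J) (i : I) : Finset J :=
  Finset.univ.filter (fun j => (i, j) ∈ G.E)

/-- The neighborhood `I_j` of an offline vertex `j`. -/
def MatchingInstance.nbrI (G : MatchingInstance I J) (j : J) : Finset I :=
  Finset.univ.filter (fun i => (i, j) ∈ G.E)

/-! ### The Natural LP -/

/-- Feasibility for the Natural LP. -/
structure NaturalLPFeasible (G : MatchingInstance I J) (x : I → J → ℝ) : Prop where
  nonneg : ∀ i j, (i, j) ∈ G.E → 0 ≤ x i j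
  online : ∀ i, ∑ j ∈ G.nbrJ i, x i j ≤ G.rate i
  offline : ∀ j, ∀ S ⊆ G.nbrI j, ∑ i ∈ S, x i j ≤ 1 - Real.exp (-∑ i ∈ S, G.rate i)

/-- The edge-weighted objective of the Natural LP. -/
def naturalLPValue (G : MatchingInstance I J) (x : I → J → ℝ) : ℝ :=
  ∑ e ∈ G.E, G.w e.1 e.2 * x e.1 e.2

/-- `x` is an optimal solution of the Natural LP. -/
def NaturalLPOptimal (G : MatchingInstance I J) (x : I → J → ℝ) : Prop :=
  NaturalLPFeasible G x ∧ ∀ y, NaturalLPFeasible G y → naturalLPValue G y ≤ naturalLPValue G x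

/-! ### The regularization term

A state `W : J → ℝ` records, for each offline vertex `j`, the maximum weight `W j` of an edge
matched to `j` so far (`0` if `j` is unmatched). -/

/-- Marginal weight `w_ij(t) = (w_ij - w_j(t))⁺`. -/
def marginal (G : MatchingInstance I J) (W : J → ℝ) (i : I) (j : J) : ℝ :=
  max (G.w i j - W j) 0

/-- `α(t)`. -/
def alphaFun (t : ℝ) : ℝ :=
  1 - 1 / (Real.exp 1 * (1 - Real.log 2)) * (2 * Real.exp 1) ^ t
    + (1 + Real.log 2) / (Real.exp 2 * (1 - Real.log 2)) * Real.exp (2 * t)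

/-- `β(t)`. -/
def betaFun (t : ℝ) : ℝ :=
  1 / (2 * Real.exp 1 * (1 - Real.log 2)) * (2 * Real.exp 1) ^ t
    - 1 / (Real.exp 2 * (1 - Real.log 2)) * Real.exp (2 * t)

/-- `p(ρ) = min {2ρ, 1}`. -/
def pFun (ρ : ℝ) : ℝ := min (2 * ρ) 1

/-- `ρ_ij(t, v)` at weight level `v`: `x_ij / λ_i` if `v ≤ w_ij(t)`, and `0` otherwise. -/
def rhoEdge (G : MatchingInstance I J) (x : I → J → ℝ) (W : J → ℝ) (i : I) (j : J) (v : ℝ) : ℝ :=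
  (if v ≤ marginal G W i j then x i j else 0) / G.rate i

/-- `ρ_i(t, v) = ∑_{j ∈ J_i} ρ_ij(t, v)`. -/
def rhoType (G : MatchingInstance I J) (x : I → J → ℝ) (W : J → ℝ) (i : I) (v : ℝ) : ℝ :=
  ∑ j ∈ G.nbrJ i, rhoEdge G x W i j v

/-- The decrease of `X(t)` if an online vertex of type `i` is matched to `j`. -/
def decreaseX (G : MatchingInstance I J) (x : I → J → ℝ) (W : J → ℝ) (i : I) (j : J) : ℝ :=
  ∑ i' ∈ G.nbrI j,
    (marginal G W i' j - max (marginal G W i' j - marginal G W i j) 0) * x i' j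

/-- The decrease of `Y(t)` if an online vertex of type `i` is matched to `j`. -/
def decreaseY (G : MatchingInstance I J) (x : I → J → ℝ) (W : J → ℝ) (i : I) (j : J) : ℝ :=
  ∑ i' ∈ G.nbrI j,
    ∫ v in (max (marginal G W i' j - marginal G W i j) 0)..(marginal G W i' j),
      G.rate i' * (pFun (rhoType G x W i' v) - pFun (rhoType G x W i' v - rhoEdge G x W i' j v))

/-- The regularization term `r_ij(t)` in state `W`. -/
def regularizer (G : MatchingInstance I J) (x : I → J → ℝ) (t : ℝ) (W : J → ℝ)
    (i : I) (j : J) : ℝ :=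
  alphaFun t * decreaseX G x W i j + betaFun t * decreaseY G x W i j

/-! ### Online decision rules -/

/-- `rule i t W` is the offline vertex to which an online vertex of type `i` arriving at time `t`
in state `W` is matched (`none` if it is left unmatched). The rule is Regularized Greedy if it
always matches to a neighbor maximizing `w_ij(t) - r_ij(t)`, whenever there is a neighbor. Ties
may be broken in any way that is measurable in time. -/
structure IsRegularizedGreedy (G : MatchingInstance I J) (x : I → J → ℝ)
    (rule : I → ℝ → (J → ℝ) → Option J) : Prop where
  isMax : ∀ i, ∀ t ∈ Icc (0 : ℝ) 1, ∀ W j, rule i t W = some j → j ∈ G.nbrJ i ∧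
    ∀ j' ∈ G.nbrJ i, marginal G W i j' - regularizer G x t W i j'
      ≤ marginal G W i j - regularizer G x t W i j
  isSome : ∀ i, ∀ t ∈ Icc (0 : ℝ) 1, ∀ W, (G.nbrJ i).Nonempty → rule i t W ≠ none
  meas : ∀ i W o, MeasurableSet {t ∈ Icc (0 : ℝ) 1 | rule i t W = o}

/-! ### Realized arrivals

A realization is given by `τ : I × ℕ → ℝ`, where `τ (i, k)` is the time of the `k`-th arrival
(counted from `0`) of type `i`. The online vertices are the `(i, k)` with `τ (i, k) ≤ 1`. -/

open Classical in
/-- The online vertices arriving by time `1` (almost surely a finite set; the value `∅` is used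
on the null event that it is infinite). -/
def arrivals (τ : I × ℕ → ℝ) : Finset (I × ℕ) :=
  if h : {a | τ a ≤ 1}.Finite then h.toFinset else ∅

/-- The online vertices in order of arrival. -/
def arrivalOrder (τ : I × ℕ → ℝ) : List (I × ℕ) :=
  (arrivals τ).toList.mergeSort (fun a b => decide (τ a ≤ τ b))

/-- The state after the online vertex `a` is processed by a decision rule, with free disposal. -/
def step (G : MatchingInstance I J) (rule : I → ℝ → (J → ℝ) → Option J) (τ : I × ℕ → ℝ)
    (W : J → ℝ) (a : I × ℕ) : J → ℝ :=
  match rule a.1 (τ a) W with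
  | none => W
  | some j => Function.update W j (max (W j) (G.w a.1 j))

/-- The objective of a decision rule on a realization: the sum over the offline vertices of the
weight of the heaviest edge matched to it, after all online vertices have been processed. -/
def algValue (G : MatchingInstance I J) (rule : I → ℝ → (J → ℝ) → Option J)
    (τ : I × ℕ → ℝ) : ℝ :=
  ∑ j, (arrivalOrder τ).foldl (step G rule τ) (fun _ => 0) j

/-- The objective, with free disposal, of the assignment `m` of online to offline vertices on a
realization: each offline vertex contributes the weight of its heaviest edge. -/
def assignmentValue (G : MatchingInstance I J) (τ : I × ℕ → ℝ) (m : I × ℕ → Option J) : ℝ :=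
  ∑ j, ((arrivals τ).filter (fun a => m a = some j)).fold max 0 (fun a => G.w a.1 j)

/-- The hindsight optimum on a realization: the supremum of the objective over all assignments
of each online vertex to at most one offline neighbor. -/
def optValue (G : MatchingInstance I J) (τ : I × ℕ → ℝ) : ℝ :=
  ⨆ m : {m : I × ℕ → Option J // ∀ a j, m a = some j → (a.1, j) ∈ G.E},
    assignmentValue G τ m

end Algorithm

/-! ### Poisson arrivals -/

/-- `gap i k` are the successive interarrival times of independent Poisson processes, one for
each `i`, with rates `rate i`: they are independent, and `gap i k` is exponential with
parameter `rate i`. -/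
structure IsPoissonArrivals {I Ω : Type*} [MeasurableSpace Ω] (μ : Measure Ω) (rate : I → ℝ)
    (gap : I → ℕ → Ω → ℝ) : Prop where
  meas : ∀ i k, Measurable (gap i k)
  law : ∀ i k, μ.map (gap i k) = expMeasure (rate i)
  indep : iIndepFun (fun a : I × ℕ => gap a.1 a.2) μ

/-- The arrival time of the online vertex `(i, k)`: the sum of the first `k + 1` gaps. -/
def arrivalTime {I Ω : Type*} (gap : I → ℕ → Ω → ℝ) (ω : Ω) (a : I × ℕ) : ℝ :=
  ∑ m ∈ Finset.range (a.2 + 1), gap a.1 m ω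

end StochMatching

end

/-!
Let `X` be the value of the given LP solution at the marginal weights of the current state, and
`Y` the rate at which top half sampling gains: on the arrival of type `i`, it proposes to the
offline vertices in order of decreasing marginal weight, so that the first of them up to any level
jointly receive probability `p` of their total fraction. The potential at time `t` is the objective
attained so far plus `α(t) X + β(t) Y`, and `w_ij(t) - r_ij(t)` is precisely its change when `i` is
matched to `j`. The greedy choice therefore raises the potential at least as fast as top half
sampling, for which the gain is `Y` and the decreases of `X` and `Y` are bounded linearly in `X`
and `Y`. The functions `α` and `β` solve the linear differential equations that make the resulting
lower bound on the drift of the potential vanish, so its expectation does not decrease.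

At time `1` the potential is the objective, since `α(1) = β(1) = 0`. At time `0` it is at least
`(α(0) + β(0)) X ≥ 0.706 X`, as `Y ≥ X`, and `X` is then the optimal value of the LP. This value is
at least the expected optimum in hindsight, because the probabilities that the optimum uses
`(i, j)` as the heaviest edge of `j` form a feasible solution.
-/

noncomputable section

namespace StochMatching

/-! ### The coefficient functions -/

lemma one_sub_log_two_pos : 0 < 1 - Real.log 2 := by
  linarith [Real.log_two_lt_d9]

lemma two_mul_exp_one_rpow (t : ℝ) :
    (2 * Real.exp 1) ^ t = Real.exp ((1 + Real.log 2) * t) := by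
  rw [Real.rpow_def_of_pos (by positivity), Real.log_mul two_ne_zero (Real.exp_ne_zero _),
    Real.log_exp, add_comm]

lemma exp_one_add_log_two : Real.exp (1 + Real.log 2) = 2 * Real.exp 1 := by
  rw [Real.exp_add, Real.exp_log two_pos, mul_comm]

lemma alphaFun_eq (t : ℝ) : alphaFun t =
    1 - 1 / (Real.exp 1 * (1 - Real.log 2)) * Real.exp ((1 + Real.log 2) * t)
      + (1 + Real.log 2) / (Real.exp 2 * (1 - Real.log 2)) * Real.exp (2 * t) := by
  rw [alphaFun, two_mul_exp_one_rpow]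

lemma betaFun_eq (t : ℝ) : betaFun t =
    1 / (2 * Real.exp 1 * (1 - Real.log 2)) * Real.exp ((1 + Real.log 2) * t)
      - 1 / (Real.exp 2 * (1 - Real.log 2)) * Real.exp (2 * t) := by
  rw [betaFun, two_mul_exp_one_rpow]

lemma hasDerivAt_exp_const_mul (c t : ℝ) :
    HasDerivAt (fun t => Real.exp (c * t)) (c * Real.exp (c * t)) t := by
  simpa [mul_comm] using ((hasDerivAt_id t).const_mul c).exp

lemma hasDerivAt_alphaFun (t : ℝ) :
    HasDerivAt alphaFun (-(2 * (1 + Real.log 2) * betaFun t)) t := by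
  have hc := one_sub_log_two_pos.ne'
  rw [funext alphaFun_eq]
  refine ((((hasDerivAt_exp_const_mul (1 + Real.log 2) t).const_mul _).const_sub 1).add
    ((hasDerivAt_exp_const_mul 2 t).const_mul _)).congr_deriv ?_
  rw [betaFun_eq]
  field_simp
  ring

lemma hasDerivAt_betaFun (t : ℝ) :
    HasDerivAt betaFun (-(1 - alphaFun t) + (3 + Real.log 2) * betaFun t) t := by
  have hc := one_sub_log_two_pos.ne'
  rw [funext betaFun_eq]
  refine (((hasDerivAt_exp_const_mul (1 + Real.log 2) t).const_mul _).sub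
    ((hasDerivAt_exp_const_mul 2 t).const_mul _)).congr_deriv ?_
  rw [← funext betaFun_eq, betaFun_eq, alphaFun_eq]
  field_simp
  ring

lemma continuous_alphaFun : Continuous alphaFun :=
  continuous_iff_continuousAt.2 fun t => (hasDerivAt_alphaFun t).continuousAt

lemma continuous_betaFun : Continuous betaFun :=
  continuous_iff_continuousAt.2 fun t => (hasDerivAt_betaFun t).continuousAt

lemma alphaFun_one : alphaFun 1 = 0 := by
  have hc := one_sub_log_two_pos.ne'
  rw [alphaFun_eq, mul_one, mul_one, exp_one_add_log_two]
  field_simp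
  ring

lemma betaFun_one : betaFun 1 = 0 := by
  have hc := one_sub_log_two_pos.ne'
  rw [betaFun_eq, mul_one, mul_one, exp_one_add_log_two]
  field_simp
  ring

lemma betaFun_nonneg {t : ℝ} (ht : t ≤ 1) : 0 ≤ betaFun t := by
  have hc := one_sub_log_two_pos
  have hexp : Real.exp (2 * t) * (2 * Real.exp 1) ≤
      Real.exp ((1 + Real.log 2) * t) * Real.exp 2 := by
    rw [← exp_one_add_log_two, ← Real.exp_add, ← Real.exp_add]
    exact Real.exp_le_exp.2 (by nlinarith)
  rw [betaFun_eq, sub_nonneg, div_mul_eq_mul_div, div_mul_eq_mul_div,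
    div_le_div_iff₀ (by positivity) (by positivity)]
  nlinarith

lemma antitoneOn_alphaFun : AntitoneOn alphaFun (Iic 1) := by
  refine antitoneOn_of_deriv_nonpos (convex_Iic 1) continuous_alphaFun.continuousOn
    (fun s _ => (hasDerivAt_alphaFun s).differentiableAt.differentiableWithinAt) fun s hs => ?_
  rw [interior_Iic] at hs
  rw [(hasDerivAt_alphaFun s).deriv, neg_nonpos]
  have hβ := betaFun_nonneg (mem_Iio.1 hs).le
  positivity

lemma alphaFun_nonneg {t : ℝ} (ht : t ≤ 1) : 0 ≤ alphaFun t :=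
  alphaFun_one ▸ antitoneOn_alphaFun (mem_Iic.2 ht) self_mem_Iic ht

lemma alphaFun_add_two_mul_betaFun_le_one (t : ℝ) : alphaFun t + 2 * betaFun t ≤ 1 := by
  have hc := one_sub_log_two_pos.ne'
  have h : alphaFun t + 2 * betaFun t = 1 - Real.exp (2 * t) / Real.exp 2 := by
    rw [alphaFun_eq, betaFun_eq]
    field_simp
    ring
  rw [h, sub_le_self_iff]
  positivity

lemma alphaFun_zero_add_betaFun_zero : alphaFun 0 + betaFun 0 =
    1 - (Real.exp 1 / 2 - Real.log 2) / (Real.exp 1 ^ 2 * (1 - Real.log 2)) := by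
  have hc := one_sub_log_two_pos.ne'
  have he : Real.exp 2 = Real.exp 1 ^ 2 := by rw [← Real.exp_nat_mul]; norm_num
  rw [alphaFun_eq, betaFun_eq, he]
  simp only [mul_zero, Real.exp_zero, mul_one]
  field_simp
  ring

lemma le_alphaFun_zero_add_betaFun_zero : 0.706 ≤ alphaFun 0 + betaFun 0 := by
  have hc := one_sub_log_two_pos
  have he := Real.exp_one_gt_d9
  have he' := Real.exp_one_lt_d9
  have hl := Real.log_two_gt_d9
  have hl' := Real.log_two_lt_d9
  have hden : (7.389 : ℝ) * 0.30685 ≤ Real.exp 1 ^ 2 * (1 - Real.log 2) :=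
    mul_le_mul (by nlinarith) (by linarith) (by norm_num) (by positivity)
  have hfrac : (Real.exp 1 / 2 - Real.log 2) / (Real.exp 1 ^ 2 * (1 - Real.log 2)) ≤ 0.294 := by
    rw [div_le_iff₀ (by positivity)]
    linarith
  rw [alphaFun_zero_add_betaFun_zero]
  linarith

/-! ### The matching probability `p` -/

lemma pFun_monotone : Monotone pFun := fun r s h => by
  unfold pFun
  gcongr

lemma pFun_le_one (r : ℝ) : pFun r ≤ 1 := min_le_right _ _

lemma pFun_le_two_mul (r : ℝ) : pFun r ≤ 2 * r := min_le_left _ _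

lemma pFun_of_le {r : ℝ} (h : r ≤ 1 / 2) : pFun r = 2 * r := min_eq_left (by linarith)

lemma pFun_of_ge {r : ℝ} (h : 1 / 2 ≤ r) : pFun r = 1 := min_eq_right (by linarith)

lemma pFun_zero : pFun 0 = 0 := by rw [pFun_of_le (by norm_num), mul_zero]

lemma le_pFun {r : ℝ} (h0 : 0 ≤ r) (h1 : r ≤ 1) : r ≤ pFun r := le_min (by linarith) h1

lemma pFun_eq_sub_max (r : ℝ) : pFun r = 2 * r - max (2 * r - 1) 0 := by
  rw [pFun, ← min_sub_sub_left, sub_sub_cancel, sub_zero, min_comm]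

lemma pFun_add_le {r s : ℝ} (hr : 0 ≤ r) (hs : 0 ≤ s) : pFun (r + s) ≤ pFun r + pFun s := by
  simp only [pFun, min_def]
  split_ifs <;> linarith

lemma pFun_sub_pFun_sub_le {r s : ℝ} (hs : 0 ≤ s) (hsr : s ≤ r) :
    pFun r - pFun (r - s) ≤ pFun s := by
  have := pFun_add_le (sub_nonneg.2 hsr) hs
  rw [sub_add_cancel] at this
  linarith

lemma max_le_pFun_sub_pFun_sub {r s : ℝ} (hs : 0 ≤ s) (hsr : s ≤ r) (hr : r ≤ 1) :
    max (2 * s - 1) 0 ≤ pFun r - pFun (r - s) := by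
  refine max_le ?_ (sub_nonneg.2 (pFun_monotone (sub_le_self r hs)))
  linarith [le_pFun (hs.trans hsr) hr, pFun_le_two_mul (r - s)]

/-- Only the `j` with `R - r j < 1 / 2`, where `R` is the total, contribute. A single such `j`
contributes at most `2 * (1 - R)`; if there are `k ≥ 2` of them, they contribute at most
`k * (1 - 2 * R) + 2 * R` together. -/
lemma sum_one_sub_pFun_sub_le {ι : Type*} {s : Finset ι} {r : ι → ℝ} (hr : ∀ j ∈ s, 0 ≤ r j)
    (hhalf : 1 / 2 ≤ ∑ j ∈ s, r j) (hone : ∑ j ∈ s, r j ≤ 1) :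
    ∑ j ∈ s, (1 - pFun (∑ k ∈ s, r k - r j) - max (2 * r j - 1) 0) ≤
      2 * (1 - ∑ k ∈ s, r k) := by
  classical
  set R := ∑ k ∈ s, r k
  set a : ι → ℝ := fun j => 1 - pFun (R - r j) - max (2 * r j - 1) 0
  set K := s.filter fun j => R - r j < 1 / 2
  have hK : ∀ j ∈ K, a j ≤ 1 - 2 * R + 2 * r j := fun j hj => by
    simp only [a, pFun_of_le (Finset.mem_filter.1 hj).2.le]
    linarith [le_max_right (2 * r j - 1) 0]
  have hK' : ∀ j ∈ K, a j ≤ 2 * (1 - R) := fun j hj => by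
    simp only [a, pFun_of_le (Finset.mem_filter.1 hj).2.le]
    linarith [le_max_left (2 * r j - 1) 0]
  have hrest : ∑ j ∈ s with ¬ R - r j < 1 / 2, a j ≤ 0 := Finset.sum_nonpos fun j hj => by
    simp only [a, pFun_of_ge (not_lt.1 (Finset.mem_filter.1 hj).2)]
    linarith [le_max_right (2 * r j - 1) 0]
  rw [← Finset.sum_filter_add_sum_filter_not s fun j => R - r j < 1 / 2]
  refine (add_le_of_nonpos_right hrest).trans ?_
  rcases Nat.lt_or_ge K.card 2 with hcard | hcard
  · have hcard : (K.card : ℝ) ≤ 1 := by exact_mod_cast Nat.le_of_lt_succ hcard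
    have := Finset.sum_le_card_nsmul K a _ hK'
    rw [nsmul_eq_mul] at this
    nlinarith
  · have hcard : (2 : ℝ) ≤ K.card := by exact_mod_cast hcard
    have hKR : ∑ j ∈ K, r j ≤ R :=
      Finset.sum_le_sum_of_subset_of_nonneg (Finset.filter_subset _ _) fun j hj _ => hr j hj
    have := Finset.sum_le_sum hK
    rw [Finset.sum_add_distrib, Finset.sum_const, nsmul_eq_mul, ← Finset.mul_sum] at this
    nlinarith

lemma sum_pFun_sub_pFun_sub_le {ι : Type*} {s : Finset ι} {r : ι → ℝ} (hr : ∀ j ∈ s, 0 ≤ r j)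
    (hone : ∑ j ∈ s, r j ≤ 1) :
    ∑ j ∈ s, (pFun (∑ k ∈ s, r k) - pFun (∑ k ∈ s, r k - r j)) ≤
      2 * pFun (∑ k ∈ s, r k) - 2 * ∑ k ∈ s, r k + ∑ j ∈ s, max (2 * r j - 1) 0 := by
  rcases le_total (∑ k ∈ s, r k) (1 / 2) with hhalf | hhalf
  · have hlin : ∀ j ∈ s, pFun (∑ k ∈ s, r k) - pFun (∑ k ∈ s, r k - r j) = 2 * r j :=
      fun j hj => by
        rw [pFun_of_le hhalf, pFun_of_le (by linarith [hr j hj])]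
        ring
    have hmax : 0 ≤ ∑ j ∈ s, max (2 * r j - 1) 0 := Finset.sum_nonneg fun j _ => le_max_right _ _
    rw [Finset.sum_congr rfl hlin, ← Finset.mul_sum, pFun_of_le hhalf]
    linarith
  · have := sum_one_sub_pFun_sub_le hr hhalf hone
    rw [Finset.sum_sub_distrib] at this
    rw [pFun_of_ge hhalf]
    linarith

/-! ### Integration by levels -/

/-- Bounded measurable real functions, a class closed under all the operations performed on the
integrands below and contained in the integrable functions of every finite measure. -/
def IsBddMeas {α : Type*} [MeasurableSpace α] (f : α → ℝ) : Prop :=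
  Measurable f ∧ ∃ C, ∀ a, |f a| ≤ C

namespace IsBddMeas

variable {α : Type*} [MeasurableSpace α] {f g : α → ℝ}

lemma const (c : ℝ) : IsBddMeas fun _ : α => c := ⟨measurable_const, |c|, fun _ => le_rfl⟩

lemma add (hf : IsBddMeas f) (hg : IsBddMeas g) : IsBddMeas fun a => f a + g a := by
  obtain ⟨hf, C, hC⟩ := hf
  obtain ⟨hg, D, hD⟩ := hg
  exact ⟨hf.add hg, C + D, fun a => (abs_add_le _ _).trans (add_le_add (hC a) (hD a))⟩

lemma mul (hf : IsBddMeas f) (hg : IsBddMeas g) : IsBddMeas fun a => f a * g a := by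
  obtain ⟨hf, C, hC⟩ := hf
  obtain ⟨hg, D, hD⟩ := hg
  refine ⟨hf.mul hg, C * D, fun a => ?_⟩
  rw [abs_mul]
  exact mul_le_mul (hC a) (hD a) (abs_nonneg _) ((abs_nonneg _).trans (hC a))

lemma const_mul (c : ℝ) (hf : IsBddMeas f) : IsBddMeas fun a => c * f a := (const c).mul hf

lemma sub (hf : IsBddMeas f) (hg : IsBddMeas g) : IsBddMeas fun a => f a - g a := by
  simpa [sub_eq_add_neg] using hf.add (hg.const_mul (-1))

lemma sum {ι : Type*} {f : ι → α → ℝ} (s : Finset ι) (hf : ∀ i, IsBddMeas (f i)) :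
    IsBddMeas fun a => ∑ i ∈ s, f i a := by
  classical
  induction s using Finset.induction_on with
  | empty => simpa using const 0
  | insert a s has ih => simpa [Finset.sum_insert has] using (hf a).add ih

lemma monotone_comp {p : ℝ → ℝ} (hp : Monotone p) (hf : IsBddMeas f) :
    IsBddMeas fun a => p (f a) := by
  obtain ⟨hf, C, hC⟩ := hf
  exact ⟨hp.measurable.comp hf, max |p (-C)| |p C|, fun a =>
    abs_le_max_abs_abs (hp (abs_le.1 (hC a)).1) (hp (abs_le.1 (hC a)).2)⟩

lemma integrable {μ : Measure α} [IsFiniteMeasure μ] (hf : IsBddMeas f) : Integrable f μ :=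
  .of_bound hf.1.aestronglyMeasurable hf.2.choose (.of_forall hf.2.choose_spec)

variable {f : ℝ → ℝ}

lemma ite_le (hf : IsBddMeas f) (m : ℝ) : IsBddMeas fun v => if v ≤ m then f v else 0 := by
  obtain ⟨hf, C, hC⟩ := hf
  refine ⟨.ite measurableSet_Iic hf measurable_const, C, fun v => ?_⟩
  beta_reduce
  split_ifs
  · exact hC v
  · simpa using (abs_nonneg _).trans (hC v)

lemma sum_filter_le {ι : Type*} {f : ι → ℝ → ℝ} (s : Finset ι) (hf : ∀ i, IsBddMeas (f i))
    (m : ι → ℝ) : IsBddMeas fun v => ∑ i ∈ s with v ≤ m i, f i v := by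
  simp only [Finset.sum_filter]
  exact sum s fun i => (hf i).ite_le (m i)

lemma comp_const_sub (hf : IsBddMeas f) (d : ℝ) : IsBddMeas fun v => f (d - v) :=
  ⟨hf.1.comp (measurable_const.sub measurable_id), hf.2.imp fun _ hC v => hC (d - v)⟩

lemma intervalIntegrable (hf : IsBddMeas f) (a b : ℝ) : IntervalIntegrable f volume a b :=
  intervalIntegrable_iff.2 (Measure.integrableOn_of_bounded (by simp)
    hf.1.aestronglyMeasurable (.of_forall hf.2.choose_spec))

end IsBddMeas

lemma integral_ite_le {f : ℝ → ℝ} {m M : ℝ} (hm : 0 ≤ m) (hM : m ≤ M) :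
    ∫ v in (0 : ℝ)..M, (if v ≤ m then f v else 0) = ∫ v in (0 : ℝ)..m, f v := by
  have hind : (fun v => if v ≤ m then f v else 0) = (Iic m).indicator f := by
    ext v
    simp [indicator]
  rw [intervalIntegral.integral_of_le (hm.trans hM), intervalIntegral.integral_of_le hm, hind,
    setIntegral_indicator measurableSet_Iic, Ioc_inter_Iic, min_eq_right hM]

lemma integral_tail_eq {f : ℝ → ℝ} {m m' M : ℝ} (hm : 0 ≤ m) (hm' : 0 ≤ m') (hM : m' ≤ M) :
    ∫ v in (max (m' - m) 0)..m', f v =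
      ∫ u in (0 : ℝ)..M, if u ≤ m then (if u ≤ m' then f (m' - u) else 0) else 0 := by
  simp only [← ite_and, ← le_min_iff]
  rw [integral_ite_le (f := fun u => f (m' - u)) (le_min hm hm') ((min_le_right _ _).trans hM),
    intervalIntegral.integral_comp_sub_left (fun v => f v), sub_zero, ← max_sub_sub_left, sub_self]

section Layers

variable {ι : Type*} {s : Finset ι} {m : ι → ℝ} {M : ℝ}

lemma integral_sum_filter_le {f : ι → ℝ → ℝ} (hf : ∀ i, IsBddMeas (f i)) (hm : ∀ i, 0 ≤ m i)
    (hM : ∀ i, m i ≤ M) :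
    ∫ v in (0 : ℝ)..M, ∑ i ∈ s with v ≤ m i, f i v = ∑ i ∈ s, ∫ v in (0 : ℝ)..m i, f i v := by
  simp only [Finset.sum_filter]
  rw [intervalIntegral.integral_finsetSum fun i _ => ((hf i).ite_le (m i)).intervalIntegrable _ _]
  exact Finset.sum_congr rfl fun i _ => integral_ite_le (hm i) (hM i)

lemma integral_sum_filter_le_const (c : ι → ℝ) (hm : ∀ i, 0 ≤ m i) (hM : ∀ i, m i ≤ M) :
    ∫ v in (0 : ℝ)..M, ∑ i ∈ s with v ≤ m i, c i = ∑ i ∈ s, m i * c i := by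
  rw [integral_sum_filter_le (f := fun i _ => c i) (fun i => .const (c i)) hm hM]
  simp

end Layers

/-! ### Top half sampling -/

/-- Processing the elements by decreasing `m` and giving each the increment of `p` at the mass
collected so far makes the first elements up to any level `v` receive `p` of their total mass. -/
lemma exists_top_sampling {ι : Type*} {p : ℝ → ℝ} (hp : Monotone p) (hp0 : p 0 = 0)
    (hadd : ∀ a b, 0 ≤ a → 0 ≤ b → p (a + b) ≤ p a + p b) (s : Finset ι) {r m : ι → ℝ}
    (hr : ∀ j, 0 ≤ r j) (hm : ∀ j, 0 ≤ m j) {M : ℝ} (hM : ∀ j, m j ≤ M) :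
    ∃ q : ι → ℝ, (∀ j, 0 ≤ q j ∧ q j ≤ p (r j)) ∧ ∑ j ∈ s, q j = p (∑ j ∈ s, r j) ∧
      ∑ j ∈ s, m j * q j = ∫ v in (0 : ℝ)..M, p (∑ j ∈ s with v ≤ m j, r j) := by
  classical
  induction s using Finset.induction_on_min_value m with
  | empty =>
    exact ⟨fun _ => 0, fun j => ⟨le_rfl, hp0 ▸ hp (hr j)⟩, by simp [hp0], by simp [hp0]⟩
  | insert a s has hmin ih =>
    obtain ⟨q, hq, hsum, hint⟩ := ih
    set R := ∑ j ∈ s, r j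
    set d := p (r a + R) - p R with hd
    have hd0 : 0 ≤ d := sub_nonneg.2 (hp (le_add_of_nonneg_left (hr a)))
    have hdp : d ≤ p (r a) := by
      linarith [hadd (r a) R (hr a) (Finset.sum_nonneg fun j _ => hr j)]
    have hlevel : ∀ v, p (∑ j ∈ insert a s with v ≤ m j, r j) =
        (if v ≤ m a then d else 0) + p (∑ j ∈ s with v ≤ m j, r j) := fun v => by
      by_cases hv : v ≤ m a
      · rw [Finset.filter_insert, if_pos hv, if_pos hv,
          Finset.filter_true_of_mem fun j hj => hv.trans (hmin j hj), Finset.sum_insert has]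
        ring
      · rw [Finset.filter_insert, if_neg hv, if_neg hv, zero_add]
    have hupdate : ∀ f : ι → ℝ, ∑ j ∈ s, f j * Function.update q a d j = ∑ j ∈ s, f j * q j :=
      fun f => Finset.sum_congr rfl fun j hj => by
        rw [Function.update_of_ne (ne_of_mem_of_not_mem hj has)]
    refine ⟨Function.update q a d, (Function.forall_update_iff q fun j x => 0 ≤ x ∧ x ≤ p (r j)).2
      ⟨⟨hd0, hdp⟩, fun j _ => hq j⟩, ?_, ?_⟩
    · have := hupdate 1
      simp only [Pi.one_apply, one_mul] at this
      rw [Finset.sum_insert has, Finset.sum_insert has, this, Function.update_self, hsum, hd]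
      ring
    · have hfilter : IsBddMeas fun v => ∑ j ∈ s with v ≤ m j, r j :=
        .sum_filter_le s (fun j => .const (r j)) m
      simp only [hlevel]
      rw [intervalIntegral.integral_add (((IsBddMeas.const d).ite_le _).intervalIntegrable _ _)
        ((hfilter.monotone_comp hp).intervalIntegrable _ _), integral_ite_le (hm a) (hM a), ← hint,
        Finset.sum_insert has, Function.update_self, hupdate]
      simp

/-! ### The mass of a type at a weight level -/

section Levels

variable {J : Type*} [Fintype J]

/-- The quantity `ρ(v)` of a type with fractions `r` and marginal weights `m`: the total fraction
assigned to offline vertices of marginal weight at least `v`. -/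
def levelMass (r m : J → ℝ) (v : ℝ) : ℝ := ∑ j with v ≤ m j, r j

/-- The decrease of `p(ρ(v))` when `j` is removed, for levels `v ≤ m j`. -/
def levelDrop (r m : J → ℝ) (j : J) (v : ℝ) : ℝ :=
  pFun (levelMass r m v) - pFun (levelMass r m v - r j)

variable {r m : J → ℝ} {j : J} {v : ℝ}

lemma isBddMeas_levelMass : IsBddMeas (levelMass r m) :=
  .sum_filter_le _ (fun j => .const (r j)) m

lemma isBddMeas_pFun_levelMass : IsBddMeas fun v => pFun (levelMass r m v) :=
  isBddMeas_levelMass.monotone_comp pFun_monotone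

lemma isBddMeas_levelDrop (j : J) : IsBddMeas (levelDrop r m j) :=
  isBddMeas_pFun_levelMass.sub
    ((isBddMeas_levelMass.sub (.const (r j))).monotone_comp pFun_monotone)

lemma levelMass_nonneg (hr : ∀ j, 0 ≤ r j) : 0 ≤ levelMass r m v :=
  Finset.sum_nonneg fun j _ => hr j

lemma levelMass_le_one (hr : ∀ j, 0 ≤ r j) (hone : ∑ j, r j ≤ 1) : levelMass r m v ≤ 1 :=
  (Finset.sum_le_univ_sum_of_nonneg hr).trans hone

lemma le_levelMass (hr : ∀ j, 0 ≤ r j) (hv : v ≤ m j) : r j ≤ levelMass r m v :=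
  Finset.single_le_sum (fun k _ => hr k) (Finset.mem_filter.2 ⟨Finset.mem_univ j, hv⟩)

lemma max_le_levelDrop (hr : ∀ j, 0 ≤ r j) (hone : ∑ j, r j ≤ 1) (hv : v ≤ m j) :
    max (2 * r j - 1) 0 ≤ levelDrop r m j v :=
  max_le_pFun_sub_pFun_sub (hr j) (le_levelMass hr hv) (levelMass_le_one hr hone)

lemma levelDrop_le (hr : ∀ j, 0 ≤ r j) (hv : v ≤ m j) : levelDrop r m j v ≤ pFun (r j) :=
  pFun_sub_pFun_sub_le (hr j) (le_levelMass hr hv)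

lemma integral_levelMass (hm : ∀ j, 0 ≤ m j) {M : ℝ} (hM : ∀ j, m j ≤ M) :
    ∫ v in (0 : ℝ)..M, levelMass r m v = ∑ j, m j * r j :=
  integral_sum_filter_le_const r hm hM

lemma sum_integral_levelDrop_le (hr : ∀ j, 0 ≤ r j) (hone : ∑ j, r j ≤ 1) (hm : ∀ j, 0 ≤ m j)
    {M : ℝ} (hM : ∀ j, m j ≤ M) (hM0 : 0 ≤ M) :
    ∑ j, ∫ v in (0 : ℝ)..m j, levelDrop r m j v ≤
      2 * (∫ v in (0 : ℝ)..M, pFun (levelMass r m v)) - 2 * ∑ j, m j * r j +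
        ∑ j, m j * max (2 * r j - 1) 0 := by
  have hp := (isBddMeas_pFun_levelMass (r := r) (m := m)).const_mul 2
  have hmass := (isBddMeas_levelMass (r := r) (m := m)).const_mul 2
  have hheavy : IsBddMeas fun v => ∑ j with v ≤ m j, max (2 * r j - 1) 0 :=
    .sum_filter_le _ (fun _ => .const _) m
  rw [← integral_sum_filter_le isBddMeas_levelDrop hm hM, ← integral_levelMass hm hM,
    ← integral_sum_filter_le_const _ hm hM, ← intervalIntegral.integral_const_mul,
    ← intervalIntegral.integral_const_mul,
    ← intervalIntegral.integral_sub (hp.intervalIntegrable _ _) (hmass.intervalIntegrable _ _),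
    ← intervalIntegral.integral_add ((hp.sub hmass).intervalIntegrable _ _)
      (hheavy.intervalIntegrable _ _)]
  exact intervalIntegral.integral_mono_on hM0
    ((IsBddMeas.sum_filter_le _ isBddMeas_levelDrop m).intervalIntegrable _ _)
    (((hp.sub hmass).add hheavy).intervalIntegrable _ _) fun v _ =>
      sum_pFun_sub_pFun_sub_le (fun j _ => hr j) (levelMass_le_one hr hone)

lemma pFun_levelMass_sub_update [DecidableEq J] {m' : ℝ} (hm' : m' ≤ m j) (v : ℝ) :
    pFun (levelMass r m v) - pFun (levelMass r (Function.update m j m') v) =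
      (if v ≤ m j then levelDrop r m j v else 0) - if v ≤ m' then levelDrop r m j v else 0 := by
  have hrest : ∀ c : ℝ, levelMass r (Function.update m j c) v =
      (if v ≤ c then r j else 0) + ∑ k ∈ Finset.univ.erase j, if v ≤ m k then r k else 0 :=
    fun c => by
      rw [levelMass, Finset.sum_filter, ← Finset.add_sum_erase _ _ (Finset.mem_univ j),
        Function.update_self]
      refine congrArg _ (Finset.sum_congr rfl fun k hk => ?_)
      rw [Function.update_of_ne (Finset.ne_of_mem_erase hk)]
  have hself := hrest (m j)
  rw [Function.update_eq_self] at hself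
  rw [levelDrop, hrest, hself]
  split_ifs with h h' h'
  · ring
  · simp
  · exact absurd (h'.trans hm') h
  · ring

lemma integral_pFun_levelMass_update [DecidableEq J] {m' M : ℝ} (h0 : 0 ≤ m') (hm' : m' ≤ m j)
    (hM : m j ≤ M) :
    ∫ v in (0 : ℝ)..M, pFun (levelMass r (Function.update m j m') v) =
      (∫ v in (0 : ℝ)..M, pFun (levelMass r m v)) - ∫ v in m'..m j, levelDrop r m j v := by
  have hdrop := isBddMeas_levelDrop (r := r) (m := m) j
  rw [eq_sub_iff_add_eq, ← eq_sub_iff_add_eq', ← intervalIntegral.integral_sub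
      (isBddMeas_pFun_levelMass.intervalIntegrable _ _)
      (isBddMeas_pFun_levelMass.intervalIntegrable _ _)]
  simp only [pFun_levelMass_sub_update hm']
  rw [intervalIntegral.integral_sub ((hdrop.ite_le _).intervalIntegrable _ _)
    ((hdrop.ite_le _).intervalIntegrable _ _), integral_ite_le (h0.trans hm') hM,
    integral_ite_le h0 (hm'.trans hM), intervalIntegral.integral_interval_sub_left
      (hdrop.intervalIntegrable _ _) (hdrop.intervalIntegrable _ _)]

end Levels

/-! ### The loss at one offline vertex -/

lemma mul_le_of_box {ε A C T D : ℝ} (hε : ε ≤ 1) (hA : A ≤ 2) (hD0 : 0 ≤ D) (hD : D ≤ ε)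
    (hC0 : 0 ≤ C) (hC : C ≤ A - D) (hT0 : D ≤ T) (hT : T ≤ A - D) :
    C * T ≤ (2 - ε) * T + ε * C - (2 - ε) * D := by
  rcases le_total C (2 - ε) with h | h
  · nlinarith [mul_nonneg (sub_nonneg.2 h) (sub_nonneg.2 hT0), mul_nonneg (sub_nonneg.2 hD) hC0]
  · have h1 : (C - 2 + ε) * (T - D) ≤ (C - 2 + ε) * (2 - 2 * D) :=
      mul_le_mul_of_nonneg_left (by linarith) (by linarith)
    have h2 : 0 ≤ (2 - D - C) * (2 - D - ε) := mul_nonneg (by linarith) (by linarith)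
    have h3 : 0 ≤ (ε - D) * D := mul_nonneg (by linarith) hD0
    nlinarith [mul_nonneg (sub_nonneg.2 hD) (by linarith : 0 ≤ 2 - D - C)]

lemma sum_mul_max_le_one_sub_log_two {I : Type*} {lam r : I → ℝ}
    (hoff : ∀ S : Finset I, ∑ i ∈ S, lam i * r i ≤ 1 - Real.exp (-∑ i ∈ S, lam i))
    (S : Finset I) : ∑ i ∈ S, lam i * max (2 * r i - 1) 0 ≤ 1 - Real.log 2 := by
  classical
  set H := S.filter fun i => 0 ≤ 2 * r i - 1
  have hheavy : ∑ i ∈ S, lam i * max (2 * r i - 1) 0 =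
      2 * ∑ i ∈ H, lam i * r i - ∑ i ∈ H, lam i := by
    rw [Finset.mul_sum, ← Finset.sum_sub_distrib, Finset.sum_filter]
    refine Finset.sum_congr rfl fun i _ => ?_
    split_ifs with h
    · rw [max_eq_left h]
      ring
    · rw [max_eq_right (not_le.1 h).le, mul_zero]
  have hexp := Real.add_one_le_exp (Real.log 2 - ∑ i ∈ H, lam i)
  rw [sub_eq_add_neg, Real.exp_add, Real.exp_log two_pos] at hexp
  linarith [hoff H]

section Box

variable {ι : Type*} [Fintype ι] {ε : ℝ} {c h x m : ι → ℝ} {d : ι → ℝ → ℝ}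

lemma sum_mul_sum_le_of_box (hε : ε ≤ 1) (h0 : ∀ i, 0 ≤ h i) (hhε : ∑ i, h i ≤ ε)
    (hx : ∑ i, x i ≤ 1) (hc0 : ∀ i, 0 ≤ c i) (hc : ∀ i, c i ≤ 2 * x i - h i) {t : ι → ℝ}
    (S : Finset ι) (ht0 : ∀ i ∈ S, h i ≤ t i) (ht : ∀ i ∈ S, t i ≤ 2 * x i - h i) :
    (∑ i ∈ S, c i) * ∑ i ∈ S, t i ≤
      (2 - ε) * ∑ i ∈ S, t i + ε * ∑ i ∈ S, c i - (2 - ε) * ∑ i ∈ S, h i := by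
  have hx0 : ∀ i, 0 ≤ x i := fun i => by linarith [h0 i, hc0 i, hc i]
  have hsub : ∑ i ∈ S, (2 * x i - h i) = 2 * ∑ i ∈ S, x i - ∑ i ∈ S, h i := by
    rw [Finset.sum_sub_distrib, Finset.mul_sum]
  refine mul_le_of_box (A := 2 * ∑ i ∈ S, x i) hε ?_ (Finset.sum_nonneg fun i _ => h0 i)
    ((Finset.sum_le_univ_sum_of_nonneg h0).trans hhε) (Finset.sum_nonneg fun i _ => hc0 i) ?_
    (Finset.sum_le_sum ht0) ?_
  · linarith [Finset.sum_le_univ_sum_of_nonneg hx0 (s := S)]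
  · exact hsub ▸ Finset.sum_le_sum fun i _ => hc i
  · exact hsub ▸ Finset.sum_le_sum ht

lemma sum_mul_sum_integral_tail_eq {M : ℝ} (c : ι → ℝ) (hd : ∀ i, IsBddMeas (d i))
    (hm : ∀ i, 0 ≤ m i) (hM : ∀ i, m i ≤ M) :
    ∑ i, c i * ∑ k, ∫ v in (max (m k - m i) 0)..(m k), d k v =
      ∫ u in (0 : ℝ)..M, (∑ i with u ≤ m i, c i) * ∑ k with u ≤ m k, d k (m k - u) := by
  have hreflect := fun k => ((hd k).comp_const_sub (m k)).ite_le (m k)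
  simp only [Finset.sum_filter, Finset.sum_mul, ite_mul, zero_mul]
  rw [intervalIntegral.integral_finsetSum fun i _ =>
    (((IsBddMeas.sum _ hreflect).const_mul (c i)).ite_le (m i)).intervalIntegrable _ _]
  refine Finset.sum_congr rfl fun i _ => ?_
  simp only [integral_tail_eq (hm i) (hm _) (hM _)]
  rw [← intervalIntegral.integral_finsetSum fun k _ =>
    ((hreflect k).ite_le (m i)).intervalIntegrable _ _, ← intervalIntegral.integral_const_mul]
  refine intervalIntegral.integral_congr fun u _ => ?_
  split_ifs <;> simp

/-- Reflecting each tail `[m k - m i, m k]` to the levels `u ≤ min (m k) (m i)` turns the double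
sum into a product at each level `u`, to which the box inequality applies. -/
lemma sum_mul_sum_integral_tail_le {M : ℝ} (hε : ε ≤ 1) (h0 : ∀ i, 0 ≤ h i)
    (hhε : ∑ i, h i ≤ ε) (hx : ∑ i, x i ≤ 1) (hc0 : ∀ i, 0 ≤ c i)
    (hc : ∀ i, c i ≤ 2 * x i - h i) (hd : ∀ i, IsBddMeas (d i))
    (hd0 : ∀ i v, v ≤ m i → h i ≤ d i v) (hdx : ∀ i v, v ≤ m i → d i v ≤ 2 * x i - h i)
    (hm : ∀ i, 0 ≤ m i) (hM : ∀ i, m i ≤ M) (hM0 : 0 ≤ M) :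
    ∑ i, c i * ∑ k, ∫ v in (max (m k - m i) 0)..(m k), d k v ≤
      (2 - ε) * ∑ i, (∫ v in (0 : ℝ)..m i, d i v) + ε * ∑ i, m i * c i
        - (2 - ε) * ∑ i, m i * h i := by
  have hreflect := fun i => (hd i).comp_const_sub (m i)
  have hC : IsBddMeas fun u => ∑ i with u ≤ m i, c i := .sum_filter_le _ (fun i => .const (c i)) m
  have hT := IsBddMeas.sum_filter_le Finset.univ hreflect m
  have hH : IsBddMeas fun u => ∑ i with u ≤ m i, h i := .sum_filter_le _ (fun i => .const (h i)) m
  have htail : ∑ i, ∫ v in (0 : ℝ)..m i, d i v =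
      ∫ u in (0 : ℝ)..M, ∑ i with u ≤ m i, d i (m i - u) := by
    rw [integral_sum_filter_le hreflect hm hM]
    exact Finset.sum_congr rfl fun i _ => by simp
  rw [sum_mul_sum_integral_tail_eq c hd hm hM, htail, ← integral_sum_filter_le_const c hm hM,
    ← integral_sum_filter_le_const h hm hM, ← intervalIntegral.integral_const_mul,
    ← intervalIntegral.integral_const_mul, ← intervalIntegral.integral_const_mul,
    ← intervalIntegral.integral_add ((hT.const_mul _).intervalIntegrable _ _)
      ((hC.const_mul _).intervalIntegrable _ _),
    ← intervalIntegral.integral_sub (((hT.const_mul _).add (hC.const_mul _)).intervalIntegrable _ _)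
      ((hH.const_mul _).intervalIntegrable _ _)]
  refine intervalIntegral.integral_mono_on hM0 ((hC.mul hT).intervalIntegrable _ _)
    ((((hT.const_mul _).add (hC.const_mul _)).sub (hH.const_mul _)).intervalIntegrable _ _)
    fun u hu => sum_mul_sum_le_of_box hε h0 hhε hx hc0 hc _ ?_ ?_
  · exact fun i _ => hd0 i _ (sub_le_self _ hu.1)
  · exact fun i _ => hdx i _ (sub_le_self _ hu.1)

end Box

/-! ### The loss under a proposal rate dominated by top half sampling -/

section Loss

variable {I J : Type*} [Fintype I] [Fintype J] {lam : I → ℝ} {r m q : I → J → ℝ} {M : ℝ}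

lemma sum_mul_tail_levelDrop_le (hlam : ∀ i, 0 ≤ lam i) (hr : ∀ i j, 0 ≤ r i j)
    (hon : ∀ i, ∑ j, r i j ≤ 1)
    (hoff : ∀ j, ∀ S : Finset I, ∑ i ∈ S, lam i * r i j ≤ 1 - Real.exp (-∑ i ∈ S, lam i))
    (hm : ∀ i j, 0 ≤ m i j) (hM : ∀ i j, m i j ≤ M) (hM0 : 0 ≤ M)
    (hq0 : ∀ i j, 0 ≤ q i j) (hq : ∀ i j, q i j ≤ pFun (r i j)) (j : J) :
    ∑ i, lam i * q i j * ∑ k, ∫ v in (max (m k j - m i j) 0)..(m k j),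
        lam k * levelDrop (r k) (m k) j v ≤
      (1 + Real.log 2) * ∑ i, lam i * (∫ v in (0 : ℝ)..m i j, levelDrop (r i) (m i) j v)
        + (1 - Real.log 2) * ∑ i, lam i * (m i j * q i j)
        - (1 + Real.log 2) * ∑ i, lam i * (m i j * max (2 * r i j - 1) 0) := by
  have hp : ∀ i, lam i * pFun (r i j) =
      2 * (lam i * r i j) - lam i * max (2 * r i j - 1) 0 := fun i => by
    rw [pFun_eq_sub_max]
    ring
  have hbox := sum_mul_sum_integral_tail_le (ε := 1 - Real.log 2) (M := M)
    (c := fun i => lam i * q i j) (h := fun i => lam i * max (2 * r i j - 1) 0)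
    (x := fun i => lam i * r i j) (m := fun i => m i j)
    (d := fun i v => lam i * levelDrop (r i) (m i) j v)
    (by linarith [Real.log_pos one_lt_two]) (fun i => mul_nonneg (hlam i) (le_max_right _ _))
    (sum_mul_max_le_one_sub_log_two (hoff j) _)
    ((hoff j _).trans (sub_le_self _ (Real.exp_pos _).le))
    (fun i => mul_nonneg (hlam i) (hq0 i j))
    (fun i => hp i ▸ mul_le_mul_of_nonneg_left (hq i j) (hlam i))
    (fun i => (isBddMeas_levelDrop j).const_mul _)
    (fun i v hv => mul_le_mul_of_nonneg_left (max_le_levelDrop (hr i) (hon i) hv) (hlam i))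
    (fun i v hv => hp i ▸ mul_le_mul_of_nonneg_left (levelDrop_le (hr i) hv) (hlam i))
    (fun i => hm i j) (fun i => hM i j) hM0
  simp only [intervalIntegral.integral_const_mul, mul_left_comm (m _ j)] at hbox ⊢
  linarith

lemma sum_sum_mul_tail_levelDrop_le (hlam : ∀ i, 0 ≤ lam i) (hr : ∀ i j, 0 ≤ r i j)
    (hon : ∀ i, ∑ j, r i j ≤ 1)
    (hoff : ∀ j, ∀ S : Finset I, ∑ i ∈ S, lam i * r i j ≤ 1 - Real.exp (-∑ i ∈ S, lam i))
    (hm : ∀ i j, 0 ≤ m i j) (hM : ∀ i j, m i j ≤ M) (hM0 : 0 ≤ M)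
    (hq0 : ∀ i j, 0 ≤ q i j) (hq : ∀ i j, q i j ≤ pFun (r i j))
    (hqm : ∀ i, ∑ j, m i j * q i j = ∫ v in (0 : ℝ)..M, pFun (levelMass (r i) (m i) v)) :
    ∑ i, ∑ j, lam i * q i j * ∑ k, ∫ v in (max (m k j - m i j) 0)..(m k j),
        lam k * levelDrop (r k) (m k) j v ≤
      (3 + Real.log 2) * ∑ i, lam i * (∫ v in (0 : ℝ)..M, pFun (levelMass (r i) (m i) v))
        - 2 * (1 + Real.log 2) * ∑ i, lam i * ∑ j, m i j * r i j := by
  rw [Finset.sum_comm]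
  refine (Finset.sum_le_sum fun j _ =>
    sum_mul_tail_levelDrop_le hlam hr hon hoff hm hM hM0 hq0 hq j).trans ?_
  have hdrop := Finset.sum_le_sum fun i (_ : i ∈ Finset.univ) => mul_le_mul_of_nonneg_left
    (sum_integral_levelDrop_le (hr i) (hon i) (hm i) (hM i) hM0) (hlam i)
  simp only [mul_add, mul_sub, mul_left_comm _ (2 : ℝ), Finset.sum_add_distrib,
    Finset.sum_sub_distrib, ← Finset.mul_sum] at hdrop ⊢
  have hswap : ∀ f : I → J → ℝ, ∑ j, ∑ i, lam i * f i j = ∑ i, lam i * ∑ j, f i j := fun f => by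
    rw [Finset.sum_comm]
    simp only [Finset.mul_sum]
  simp only [hswap, hqm]
  have := mul_le_mul_of_nonneg_left hdrop
    (by linarith [Real.log_pos one_lt_two] : 0 ≤ 1 + Real.log 2)
  linarith

end Loss

/-! ### The state and the fractional solution -/

section Fraction

variable {I J : Type*} [DecidableEq I] [DecidableEq J] {G : MatchingInstance I J}
  {x : I → J → ℝ}

lemma mem_nbrJ [Fintype J] {i : I} {j : J} : j ∈ G.nbrJ i ↔ (i, j) ∈ G.E := by
  simp [MatchingInstance.nbrJ]

lemma mem_nbrI [Fintype I] {i : I} {j : J} : i ∈ G.nbrI j ↔ (i, j) ∈ G.E := by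
  simp [MatchingInstance.nbrI]

/-- The fraction `x i j / λ i` of type `i` assigned to `j` by a solution of the Natural LP,
extended by `0` to non-edges so that sums may range over all vertices. -/
def lpFraction (G : MatchingInstance I J) (x : I → J → ℝ) (i : I) (j : J) : ℝ :=
  if (i, j) ∈ G.E then x i j / G.rate i else 0

lemma rate_mul_lpFraction (i : I) (j : J) :
    G.rate i * lpFraction G x i j = if (i, j) ∈ G.E then x i j else 0 := by
  rw [lpFraction, mul_ite, mul_zero, mul_div_cancel₀ _ (G.rate_pos i).ne']

variable [Fintype I] [Fintype J]

lemma lpFraction_nonneg (hx : NaturalLPFeasible G x) (i : I) (j : J) : 0 ≤ lpFraction G x i j := by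
  unfold lpFraction
  split_ifs with h
  exacts [div_nonneg (hx.nonneg i j h) (G.rate_pos i).le, le_rfl]

lemma sum_lpFraction_le_one (hx : NaturalLPFeasible G x) (i : I) :
    ∑ j, lpFraction G x i j ≤ 1 := by
  have honline := hx.online i
  rw [MatchingInstance.nbrJ, Finset.sum_filter] at honline
  simp only [← rate_mul_lpFraction, ← Finset.mul_sum] at honline
  exact le_of_mul_le_mul_left (by rwa [mul_one]) (G.rate_pos i)

lemma sum_rate_mul_lpFraction_le (hx : NaturalLPFeasible G x) (j : J) (S : Finset I) :
    ∑ i ∈ S, G.rate i * lpFraction G x i j ≤ 1 - Real.exp (-∑ i ∈ S, G.rate i) := by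
  simp only [rate_mul_lpFraction]
  rw [← Finset.sum_filter]
  refine (hx.offline j _ fun i hi => mem_nbrI.2 (Finset.mem_filter.1 hi).2).trans ?_
  gcongr 1 - Real.exp (-?_)
  exact Finset.sum_le_sum_of_subset_of_nonneg (Finset.filter_subset _ _)
    fun i _ _ => (G.rate_pos i).le

lemma sum_rate_mul_lpFraction_le_one (hx : NaturalLPFeasible G x) (j : J) :
    ∑ i, G.rate i * lpFraction G x i j ≤ 1 :=
  (sum_rate_mul_lpFraction_le hx j _).trans (sub_le_self _ (Real.exp_pos _).le)

end Fraction

section State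

variable {I J : Type*} {G : MatchingInstance I J} {W : J → ℝ}

lemma marginal_nonneg (i : I) (j : J) : 0 ≤ marginal G W i j := le_max_right _ _

/-- The marginal weight `w_kj(t)` after an online vertex of type `i` is matched to `j`. -/
abbrev loweredMarginal (G : MatchingInstance I J) (W : J → ℝ) (i k : I) (j : J) : ℝ :=
  max (marginal G W k j - marginal G W i j) 0

lemma loweredMarginal_le (i k : I) (j : J) : loweredMarginal G W i k j ≤ marginal G W k j :=
  max_le (sub_le_self _ (marginal_nonneg i j)) (marginal_nonneg k j)

lemma max_weight_eq_add_marginal (i : I) (j : J) :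
    max (W j) (G.w i j) = W j + marginal G W i j := by
  rw [marginal, ← max_add_add_left, add_sub_cancel, add_zero, max_comm]

section Bound

variable [Fintype J] [Fintype I]

/-- An upper bound on all marginal weights. -/
def weightBound (G : MatchingInstance I J) : ℝ := ∑ i, ∑ j, |G.w i j|

lemma weightBound_nonneg : 0 ≤ weightBound G :=
  Finset.sum_nonneg fun _ _ => Finset.sum_nonneg fun _ _ => abs_nonneg _

lemma abs_weight_le_weightBound (i : I) (j : J) : |G.w i j| ≤ weightBound G :=
  (Finset.single_le_sum (f := fun j => |G.w i j|) (fun _ _ => abs_nonneg _)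
    (Finset.mem_univ j)).trans
    (Finset.single_le_sum (f := fun i => ∑ j, |G.w i j|)
      (fun _ _ => Finset.sum_nonneg fun _ _ => abs_nonneg _) (Finset.mem_univ i))

lemma marginal_le_weightBound (hW : ∀ j, 0 ≤ W j) (i : I) (j : J) :
    marginal G W i j ≤ weightBound G :=
  max_le (by linarith [hW j, le_abs_self (G.w i j), abs_weight_le_weightBound (G := G) i j])
    weightBound_nonneg

end Bound

variable [DecidableEq J]

/-- The state after an online vertex of type `i` is matched according to `o`. -/
def nextState (G : MatchingInstance I J) (W : J → ℝ) (i : I) : Option J → J → ℝ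
  | none => W
  | some j => Function.update W j (max (W j) (G.w i j))

lemma marginal_nextState (i k : I) (j : J) :
    marginal G (nextState G W i (some j)) k =
      Function.update (marginal G W k) j (loweredMarginal G W i k j) := by
  ext l
  rcases eq_or_ne l j with rfl | hl
  · rw [Function.update_self, marginal, nextState, Function.update_self,
      max_weight_eq_add_marginal, ← sub_sub, loweredMarginal]
    rcases le_total (G.w k l) (W l) with h | h
    · have hi : 0 ≤ marginal G W i l := marginal_nonneg i l
      rw [max_eq_right (by linarith), marginal, max_eq_right (sub_nonpos.2 h),
        max_eq_right (by linarith)]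
    · have hk : marginal G W k l = G.w k l - W l := max_eq_left (sub_nonneg.2 h)
      rw [hk]
  · simp only [marginal, nextState, Function.update_of_ne hl]

variable [Fintype J]

lemma sum_nextState (i : I) (j : J) :
    ∑ k, nextState G W i (some j) k = ∑ k, W k + marginal G W i j := by
  rw [nextState, Finset.sum_update_of_mem (Finset.mem_univ j), max_weight_eq_add_marginal,
    ← Finset.sum_sdiff (Finset.subset_univ {j}), Finset.sum_singleton]
  ring

end State

/-! ### The potential -/

section Potential

variable {I J : Type*} [DecidableEq I] [DecidableEq J]
  {G : MatchingInstance I J} {x : I → J → ℝ} {W : J → ℝ}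

lemma decreaseX_eq [Fintype I] (i : I) (j : J) : decreaseX G x W i j =
    ∑ k, G.rate k *
      ((marginal G W k j - loweredMarginal G W i k j) * lpFraction G x k j) := by
  simp only [mul_left_comm (G.rate _), rate_mul_lpFraction, mul_ite, mul_zero]
  rw [decreaseX, MatchingInstance.nbrI, Finset.sum_filter]

lemma rhoType_eq_levelMass [Fintype J] (i : I) (v : ℝ) :
    rhoType G x W i v = levelMass (lpFraction G x i) (marginal G W i) v := by
  rw [rhoType, MatchingInstance.nbrJ, levelMass, Finset.sum_filter, Finset.sum_filter]
  refine Finset.sum_congr rfl fun j _ => ?_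
  rw [rhoEdge, lpFraction]
  split_ifs <;> simp

variable [Fintype I] [Fintype J]

lemma decreaseY_eq (i : I) (j : J) : decreaseY G x W i j =
    ∑ k, ∫ v in (loweredMarginal G W i k j)..(marginal G W k j),
      G.rate k * levelDrop (lpFraction G x k) (marginal G W k) j v := by
  rw [decreaseY, MatchingInstance.nbrI, Finset.sum_filter]
  refine Finset.sum_congr rfl fun k _ => ?_
  split_ifs with hE
  · rw [intervalIntegral.integral_of_le (loweredMarginal_le i k j),
      intervalIntegral.integral_of_le (loweredMarginal_le i k j)]
    refine setIntegral_congr_fun measurableSet_Ioc fun v hv => ?_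
    simp only [rhoType_eq_levelMass, levelDrop, rhoEdge, if_pos hv.2, lpFraction, if_pos hE]
  · simp [levelDrop, lpFraction, hE]

/-- The quantity `X(t)` in state `W`: the fractional matching valued at the marginal weights. -/
def potX (G : MatchingInstance I J) (x : I → J → ℝ) (W : J → ℝ) : ℝ :=
  ∑ i, G.rate i * ∑ j, marginal G W i j * lpFraction G x i j

/-- The quantity `Y(t)` in state `W`: the expected gain rate of top half sampling. -/
def potY (G : MatchingInstance I J) (x : I → J → ℝ) (W : J → ℝ) : ℝ :=
  ∑ i, G.rate i * ∫ v in (0 : ℝ)..weightBound G,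
    pFun (levelMass (lpFraction G x i) (marginal G W i) v)

lemma potX_nextState (i : I) (j : J) :
    potX G x (nextState G W i (some j)) = potX G x W - decreaseX G x W i j := by
  rw [decreaseX_eq, potX, potX, ← Finset.sum_sub_distrib]
  refine Finset.sum_congr rfl fun k _ => ?_
  rw [marginal_nextState, ← mul_sub, ← Finset.add_sum_erase _ _ (Finset.mem_univ j),
    ← Finset.add_sum_erase _ (fun l => marginal G W k l * _) (Finset.mem_univ j),
    Finset.sum_congr rfl fun l hl => by rw [Function.update_of_ne (Finset.ne_of_mem_erase hl)],
    Function.update_self]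
  ring

lemma potY_nextState (hW : ∀ j, 0 ≤ W j) (i : I) (j : J) :
    potY G x (nextState G W i (some j)) = potY G x W - decreaseY G x W i j := by
  rw [decreaseY_eq, potY, potY, ← Finset.sum_sub_distrib]
  refine Finset.sum_congr rfl fun k _ => ?_
  rw [intervalIntegral.integral_const_mul, ← mul_sub, marginal_nextState,
    integral_pFun_levelMass_update (le_max_right _ _) (loweredMarginal_le i k j)
      (marginal_le_weightBound hW k j)]

lemma decreaseX_le (hx : NaturalLPFeasible G x) (i : I) (j : J) :
    decreaseX G x W i j ≤ marginal G W i j := by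
  calc decreaseX G x W i j ≤ ∑ k, marginal G W i j * (G.rate k * lpFraction G x k j) := by
        rw [decreaseX_eq]
        refine Finset.sum_le_sum fun k _ => ?_
        rw [mul_left_comm]
        refine mul_le_mul_of_nonneg_right ?_
          (mul_nonneg (G.rate_pos k).le (lpFraction_nonneg hx k j))
        linarith [le_max_left (marginal G W k j - marginal G W i j) 0]
    _ ≤ marginal G W i j := by
        rw [← Finset.mul_sum]
        exact mul_le_of_le_one_right (marginal_nonneg i j) (sum_rate_mul_lpFraction_le_one hx j)

lemma decreaseY_le (hx : NaturalLPFeasible G x) (i : I) (j : J) :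
    decreaseY G x W i j ≤ 2 * decreaseX G x W i j := by
  rw [decreaseX_eq, decreaseY_eq, Finset.mul_sum]
  refine Finset.sum_le_sum fun k _ => ?_
  calc ∫ v in (loweredMarginal G W i k j)..(marginal G W k j),
        G.rate k * levelDrop (lpFraction G x k) (marginal G W k) j v
      ≤ ∫ _ in (loweredMarginal G W i k j)..(marginal G W k j),
          G.rate k * (2 * lpFraction G x k j) := by
        refine intervalIntegral.integral_mono_on (loweredMarginal_le i k j)
          (((isBddMeas_levelDrop j).const_mul _).intervalIntegrable _ _) intervalIntegrable_const
          fun v hv => mul_le_mul_of_nonneg_left ?_ (G.rate_pos k).le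
        exact (levelDrop_le (lpFraction_nonneg hx k) hv.2).trans (pFun_le_two_mul _)
    _ = 2 * (G.rate k *
          ((marginal G W k j - loweredMarginal G W i k j) * lpFraction G x k j)) := by
        rw [intervalIntegral.integral_const, smul_eq_mul]
        ring

lemma marginal_sub_regularizer_nonneg (hx : NaturalLPFeasible G x) {t : ℝ} (ht : t ≤ 1)
    (i : I) (j : J) : 0 ≤ marginal G W i j - regularizer G x t W i j := by
  have hX := decreaseX_le (W := W) hx i j
  have hY := (decreaseY_le (W := W) hx i j).trans (mul_le_mul_of_nonneg_left hX zero_le_two)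
  have hαβ := mul_le_mul_of_nonneg_right (alphaFun_add_two_mul_betaFun_le_one t)
    (marginal_nonneg (G := G) (W := W) i j)
  rw [regularizer]
  linarith [mul_le_mul_of_nonneg_left hX (alphaFun_nonneg ht),
    mul_le_mul_of_nonneg_left hY (betaFun_nonneg ht)]

/-- The potential of a state at time `t`: the objective attained so far, plus the value
`α(t) X + β(t) Y` that the algorithm can still expect to gain. -/
def potential (G : MatchingInstance I J) (x : I → J → ℝ) (t : ℝ) (W : J → ℝ) : ℝ :=
  ∑ j, W j + (alphaFun t * potX G x W + betaFun t * potY G x W)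

/-- The time derivative of the potential, expressed through `α` and `β` themselves. -/
def potentialDeriv (G : MatchingInstance I J) (x : I → J → ℝ) (t : ℝ) (W : J → ℝ) : ℝ :=
  -(2 * (1 + Real.log 2) * betaFun t) * potX G x W +
    (-(1 - alphaFun t) + (3 + Real.log 2) * betaFun t) * potY G x W

lemma hasDerivAt_potential (t : ℝ) (W : J → ℝ) :
    HasDerivAt (fun t => potential G x t W) (potentialDeriv G x t W) t :=
  (((hasDerivAt_alphaFun t).mul_const _).add ((hasDerivAt_betaFun t).mul_const _)).const_add _

lemma continuous_potentialDeriv (W : J → ℝ) : Continuous fun t => potentialDeriv G x t W := by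
  have := continuous_alphaFun
  have := continuous_betaFun
  unfold potentialDeriv
  fun_prop

lemma potential_one (W : J → ℝ) : potential G x 1 W = ∑ j, W j := by
  simp [potential, alphaFun_one, betaFun_one]

lemma potential_nextState (hW : ∀ j, 0 ≤ W j) (t : ℝ) (i : I) (j : J) :
    potential G x t (nextState G W i (some j)) =
      potential G x t W + (marginal G W i j - regularizer G x t W i j) := by
  rw [potential, potential, regularizer, sum_nextState, potX_nextState, potY_nextState hW]
  ring

variable {rule : I → ℝ → (J → ℝ) → Option J}

lemma sum_mul_le_potential_gain (hx : NaturalLPFeasible G x)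
    (hrule : IsRegularizedGreedy G x rule) {t : ℝ} (ht : t ∈ Icc (0 : ℝ) 1) (hW : ∀ j, 0 ≤ W j)
    (i : I) {q : J → ℝ} (hq0 : ∀ j, 0 ≤ q j) (hq1 : ∑ j, q j ≤ 1)
    (hqE : ∀ j, (i, j) ∉ G.E → q j = 0) :
    ∑ j, q j * (marginal G W i j - regularizer G x t W i j) ≤
      potential G x t (nextState G W i (rule i t W)) - potential G x t W := by
  rcases hj₀ : rule i t W with _ | j₀
  · have hq : ∀ j, q j = 0 := fun j => hqE j fun hj =>
      hrule.isSome i t ht W ⟨j, mem_nbrJ.2 hj⟩ hj₀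
    simp [hq, nextState]
  · have hmax := (hrule.isMax i t ht W j₀ hj₀).2
    rw [potential_nextState hW, add_sub_cancel_left]
    set gain := marginal G W i j₀ - regularizer G x t W i j₀
    calc ∑ j, q j * (marginal G W i j - regularizer G x t W i j)
        ≤ ∑ j, q j * gain := by
          refine Finset.sum_le_sum fun j _ => ?_
          by_cases hj : (i, j) ∈ G.E
          · exact mul_le_mul_of_nonneg_left (hmax j (mem_nbrJ.2 hj)) (hq0 j)
          · simp [hqE j hj]
      _ ≤ gain := by
          rw [← Finset.sum_mul]
          exact mul_le_of_le_one_left (marginal_sub_regularizer_nonneg hx ht.2 i j₀) hq1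

variable (W) in
lemma exists_proposal (hx : NaturalLPFeasible G x) (hW : ∀ j, 0 ≤ W j) :
    ∃ q : I → J → ℝ, (∀ i j, 0 ≤ q i j) ∧ (∀ i, ∑ j, q i j ≤ 1) ∧
      (∀ i j, (i, j) ∉ G.E → q i j = 0) ∧
      ∑ i, G.rate i * ∑ j, q i j * marginal G W i j = potY G x W ∧
      ∑ i, G.rate i * ∑ j, q i j * decreaseX G x W i j ≤ potY G x W ∧
      ∑ i, G.rate i * ∑ j, q i j * decreaseY G x W i j ≤
        (3 + Real.log 2) * potY G x W - 2 * (1 + Real.log 2) * potX G x W := by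
  choose q hq hqsum hqm using fun i => exists_top_sampling pFun_monotone pFun_zero
    (fun _ _ => pFun_add_le) Finset.univ (lpFraction_nonneg hx i)
    (marginal_nonneg (G := G) (W := W) i) (marginal_le_weightBound hW i)
  have hgain : ∑ i, G.rate i * ∑ j, q i j * marginal G W i j = potY G x W := by
    simp only [mul_comm (q _ _)]
    exact Finset.sum_congr rfl fun i _ => congrArg _ (hqm i)
  refine ⟨q, fun i j => (hq i j).1, fun i => (hqsum i).trans_le (pFun_le_one _),
    fun i j hij => ?_, hgain, hgain ▸ ?_, ?_⟩
  · have := hq i j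
    rw [lpFraction, if_neg hij, pFun_zero] at this
    exact le_antisymm this.2 this.1
  · gcongr with i _ j _
    exacts [(G.rate_pos i).le, (hq i j).1, decreaseX_le hx i j]
  · have := sum_sum_mul_tail_levelDrop_le (fun i => (G.rate_pos i).le) (lpFraction_nonneg hx)
      (sum_lpFraction_le_one hx) (sum_rate_mul_lpFraction_le hx) marginal_nonneg
      (marginal_le_weightBound hW) weightBound_nonneg (fun i j => (hq i j).1)
      (fun i j => (hq i j).2) hqm
    refine le_of_eq_of_le (Finset.sum_congr rfl fun i _ => ?_) this
    rw [Finset.mul_sum]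
    simp only [decreaseY_eq, mul_assoc]

lemma potential_drift_nonneg (hx : NaturalLPFeasible G x) (hrule : IsRegularizedGreedy G x rule)
    {t : ℝ} (ht : t ∈ Icc (0 : ℝ) 1) (hW : ∀ j, 0 ≤ W j) :
    0 ≤ potentialDeriv G x t W + ∑ i, G.rate i *
      (potential G x t (nextState G W i (rule i t W)) - potential G x t W) := by
  obtain ⟨q, hq0, hq1, hqE, hgain, hX, hY⟩ := exists_proposal W hx hW
  have hgreedy : ∑ i, G.rate i * ∑ j, q i j * (marginal G W i j - regularizer G x t W i j) ≤
      ∑ i, G.rate i * (potential G x t (nextState G W i (rule i t W)) - potential G x t W) :=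
    Finset.sum_le_sum fun i _ => mul_le_mul_of_nonneg_left
      (sum_mul_le_potential_gain hx hrule ht hW i (hq0 i) (hq1 i) (hqE i)) (G.rate_pos i).le
  have hexpand : ∑ i, G.rate i * ∑ j, q i j * (marginal G W i j - regularizer G x t W i j) =
      potY G x W - alphaFun t * ∑ i, G.rate i * ∑ j, q i j * decreaseX G x W i j
        - betaFun t * ∑ i, G.rate i * ∑ j, q i j * decreaseY G x W i j := by
    simp only [← hgain, Finset.mul_sum, ← Finset.sum_sub_distrib, regularizer]
    refine Finset.sum_congr rfl fun i _ => Finset.sum_congr rfl fun j _ => ?_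
    ring
  rw [potentialDeriv]
  linarith [mul_le_mul_of_nonneg_left hX (alphaFun_nonneg ht.2),
    mul_le_mul_of_nonneg_left hY (betaFun_nonneg ht.2)]

lemma potX_le_potY (hx : NaturalLPFeasible G x) (hW : ∀ j, 0 ≤ W j) :
    potX G x W ≤ potY G x W := by
  refine Finset.sum_le_sum fun i _ => mul_le_mul_of_nonneg_left ?_ (G.rate_pos i).le
  have hr := lpFraction_nonneg hx i
  rw [← integral_levelMass (marginal_nonneg i) (marginal_le_weightBound hW i)]
  exact intervalIntegral.integral_mono_on weightBound_nonneg
    (isBddMeas_levelMass.intervalIntegrable _ _) (isBddMeas_pFun_levelMass.intervalIntegrable _ _)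
    fun v _ => le_pFun (levelMass_nonneg hr) (levelMass_le_one hr (sum_lpFraction_le_one hx i))

lemma potX_zero : potX G x (fun _ => 0) = naturalLPValue G x := by
  have hedge : ∀ i j, marginal G (fun _ => 0) i j * (G.rate i * lpFraction G x i j) =
      if (i, j) ∈ G.E then G.w i j * x i j else 0 := fun i j => by
    rw [rate_mul_lpFraction]
    split_ifs with hE
    · rw [marginal, sub_zero, max_eq_left (G.w_pos i j hE).le]
    · rw [mul_zero]
  simp only [potX, Finset.mul_sum, mul_left_comm (G.rate _), hedge]
  rw [← Fintype.sum_prod_type' fun i j => if (i, j) ∈ G.E then G.w i j * x i j else 0]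
  simp [naturalLPValue]

lemma le_potential_zero (hx : NaturalLPFeasible G x) :
    0.706 * naturalLPValue G x ≤ potential G x 0 (fun _ => 0) := by
  have hXY := potX_le_potY hx (W := fun _ => 0) fun _ => le_rfl
  have hX0 : 0 ≤ potX G x fun _ => 0 := Finset.sum_nonneg fun i _ =>
    mul_nonneg (G.rate_pos i).le (Finset.sum_nonneg fun j _ =>
      mul_nonneg (marginal_nonneg i j) (lpFraction_nonneg hx i j))
  rw [potential, Finset.sum_const_zero, zero_add, ← potX_zero]
  linarith [mul_le_mul_of_nonneg_left hXY (betaFun_nonneg zero_le_one),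
    mul_le_mul_of_nonneg_right le_alphaFun_zero_add_betaFun_zero hX0]

end Potential

/-! ### The compensator of an exponential waiting time -/

section Exponential

open scoped ENNReal

variable {r : ℝ}

lemma expMeasure_eq_withDensity : expMeasure r = volume.withDensity (exponentialPDF r) := rfl

lemma lintegral_expMeasure {f : ℝ → ℝ≥0∞} (hf : Measurable f) :
    ∫⁻ y, f y ∂expMeasure r =
      ∫⁻ y in Ioi (0 : ℝ), ENNReal.ofReal (r * Real.exp (-(r * y))) * f y := by
  have hpdf : Measurable (exponentialPDF r) := (measurable_exponentialPDFReal r).ennreal_ofReal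
  rw [expMeasure_eq_withDensity, lintegral_withDensity_eq_lintegral_mul _ hpdf hf,
    ← lintegral_indicator measurableSet_Ioi]
  refine lintegral_congr_ae ?_
  filter_upwards [Measure.ae_ne volume (0 : ℝ)] with y hy
  rcases lt_or_gt_of_ne hy with hy | hy
  · rw [indicator_of_notMem (notMem_Ioi.2 hy.le), Pi.mul_apply, exponentialPDF_of_neg hy, zero_mul]
  · rw [indicator_of_mem (mem_Ioi.2 hy), Pi.mul_apply, exponentialPDF_of_nonneg hy.le]

lemma expMeasure_Iic (hr : 0 < r) {x : ℝ} (hx : 0 ≤ x) :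
    expMeasure r (Iic x) = ENNReal.ofReal (1 - Real.exp (-(r * x))) := by
  have := isProbabilityMeasure_expMeasure hr
  rw [← ofReal_cdf, cdf_expMeasure_eq hr, if_pos hx]

lemma expMeasure_Ioi (hr : 0 < r) {x : ℝ} (hx : 0 ≤ x) :
    expMeasure r (Ioi x) = ENNReal.ofReal (Real.exp (-(r * x))) := by
  have := isProbabilityMeasure_expMeasure hr
  have hexp : Real.exp (-(r * x)) ≤ 1 := Real.exp_le_one_iff.2 (neg_nonpos.2 (by positivity))
  rw [← compl_Iic, prob_compl_eq_one_sub measurableSet_Iic, expMeasure_Iic hr hx,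
    ← ENNReal.ofReal_one, ← ENNReal.ofReal_sub _ (sub_nonneg.2 hexp), sub_sub_cancel]

lemma ae_pos_expMeasure (hr : 0 < r) : ∀ᵐ y ∂expMeasure r, 0 < y := by
  simp only [ae_iff, not_lt]
  exact (expMeasure_Iic hr le_rfl).trans (by simp)

lemma expMeasure_singleton (x : ℝ) : expMeasure r {x} = 0 :=
  withDensity_absolutelyContinuous _ _ (measure_singleton x)

lemma lintegral_expMeasure_eq (hr : 0 < r) {f : ℝ → ℝ≥0∞} (hf : Measurable f) :
    ∫⁻ y, f y ∂expMeasure r =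
      ENNReal.ofReal r * ∫⁻ z, (∫⁻ y in Ioo 0 z, f y) ∂expMeasure r := by
  have := isProbabilityMeasure_expMeasure hr
  have hIoo : ∀ z, ∫⁻ y in Ioo 0 z, f y =
      ∫⁻ y in Ioi (0 : ℝ), (Ioi y).indicator (fun _ => f y) z := fun z => by
    rw [← Ioi_inter_Iio, inter_comm, ← setLIntegral_indicator measurableSet_Iio]
    simp only [indicator, mem_Iio, mem_Ioi]
  have hmeas : Measurable fun p : ℝ × ℝ => (Ioi p.2).indicator (fun _ => f p.2) p.1 :=
    (hf.comp measurable_snd).indicator (measurableSet_lt measurable_snd measurable_fst)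
  simp only [hIoo]
  rw [lintegral_lintegral_swap hmeas.aemeasurable, lintegral_expMeasure hf,
    ← lintegral_const_mul' _ _ ENNReal.ofReal_ne_top]
  refine setLIntegral_congr_fun measurableSet_Ioi fun y hy => ?_
  rw [lintegral_indicator measurableSet_Ioi, setLIntegral_const, expMeasure_Ioi hr (le_of_lt hy),
    ENNReal.ofReal_mul hr.le]
  ring

end Exponential

/-! ### Independent exponential gaps -/

section ArrivalTimes

variable {I : Type*} {g : I × ℕ → ℝ}

/-- The time of the arrival `a` if the successive gaps between arrivals of type `i` are
`g (i, 0), g (i, 1), …`; this is `arrivalTime` on the space of gaps. -/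
def arrTime (g : I × ℕ → ℝ) (a : I × ℕ) : ℝ := ∑ m ∈ Finset.range (a.2 + 1), g (a.1, m)

/-- The time of the arrival preceding `a` among those of its type, or `0` if there is none. -/
def prevTime (g : I × ℕ → ℝ) (a : I × ℕ) : ℝ := ∑ m ∈ Finset.range a.2, g (a.1, m)

lemma arrTime_eq (g : I × ℕ → ℝ) (a : I × ℕ) : arrTime g a = prevTime g a + g a :=
  Finset.sum_range_succ _ _

lemma prevTime_zero (g : I × ℕ → ℝ) (i : I) : prevTime g (i, 0) = 0 := Finset.sum_range_zero _

lemma prevTime_succ (g : I × ℕ → ℝ) (i : I) (k : ℕ) : prevTime g (i, k + 1) = arrTime g (i, k) :=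
  rfl

lemma measurable_arrTime (a : I × ℕ) : Measurable fun g : I × ℕ → ℝ => arrTime g a :=
  Finset.measurable_sum _ fun _ _ => measurable_pi_apply _

lemma measurable_prevTime (a : I × ℕ) : Measurable fun g : I × ℕ → ℝ => prevTime g a :=
  Finset.measurable_sum _ fun _ _ => measurable_pi_apply _

lemma strictMono_arrTime (hg : ∀ b, 0 < g b) (i : I) : StrictMono fun k => arrTime g (i, k) :=
  strictMono_nat_of_lt_succ fun k => by
    rw [arrTime_eq g (i, k + 1), prevTime_succ]
    exact lt_add_of_pos_right _ (hg _)

lemma arrTime_pos (hg : ∀ b, 0 < g b) (a : I × ℕ) : 0 < arrTime g a :=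
  Finset.sum_pos (fun _ _ => hg _) Finset.nonempty_range_add_one

lemma pairwise_disjoint_gap (hg : ∀ b, 0 < g b) (i : I) :
    Pairwise (Function.onFun Disjoint fun k => Ioo (prevTime g (i, k)) (arrTime g (i, k))) := by
  refine (pairwise_disjoint_on _).2 fun k l hkl => ?_
  obtain ⟨l, rfl⟩ := Nat.exists_eq_succ_of_ne_zero (Nat.ne_zero_of_lt hkl)
  have hle : arrTime g (i, k) ≤ prevTime g (i, l + 1) :=
    (strictMono_arrTime hg i).monotone (Nat.le_of_lt_succ hkl)
  exact Set.disjoint_left.2 fun t ht ht' => (ht.2.trans_le hle).not_gt ht'.1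

lemma mem_iUnion_gap {i : I} {t : ℝ} (ht0 : 0 < t) (hex : ∃ k, t < arrTime g (i, k))
    (ht : ∀ k, arrTime g (i, k) ≠ t) :
    t ∈ ⋃ k, Ioo (prevTime g (i, k)) (arrTime g (i, k)) := by
  classical
  refine mem_iUnion.2 ⟨Nat.find hex, ?_, Nat.find_spec hex⟩
  rcases hk : Nat.find hex with _ | k
  · rwa [prevTime_zero]
  · rw [prevTime_succ]
    exact (not_lt.1 (Nat.find_min hex (hk ▸ k.lt_succ_self))).lt_of_ne (ht k)

variable [DecidableEq I]

lemma prevTime_update (g : I × ℕ → ℝ) (a : I × ℕ) (y : ℝ) :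
    prevTime (Function.update g a y) a = prevTime g a :=
  Finset.sum_congr rfl fun _ hm => Function.update_of_ne
    (fun h => (Finset.mem_range.1 hm).ne (congrArg Prod.snd h)) _ _

lemma arrTime_update_self (g : I × ℕ → ℝ) (a : I × ℕ) (y : ℝ) :
    arrTime (Function.update g a y) a = prevTime g a + y := by
  rw [arrTime_eq, prevTime_update, Function.update_self]

lemma arrTime_update_of_ne (g : I × ℕ → ℝ) {a b : I × ℕ} (y : ℝ) (h : b.1 ≠ a.1 ∨ b.2 < a.2) :
    arrTime (Function.update g a y) b = arrTime g b := by
  refine Finset.sum_congr rfl fun m hm => Function.update_of_ne ?_ _ _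
  rintro rfl
  exact h.elim (fun h => h rfl) fun h => (Nat.lt_succ_iff.1 (Finset.mem_range.1 hm)).not_gt h

end ArrivalTimes

section GapLaw

open scoped ENNReal

/-- `P` is the law of a family of independent gaps, exponential of rate `lam i` for type `i`. All
that is needed of this law is its invariance under resampling a single gap. -/
structure IsGapLaw {I : Type*} [DecidableEq I] (lam : I → ℝ) (P : Measure (I × ℕ → ℝ)) : Prop where
  pos : ∀ i, 0 < lam i
  prob : IsProbabilityMeasure P
  resample : ∀ a, (P.prod (expMeasure (lam a.1))).map (fun p => Function.update p.1 a p.2) = P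

lemma preimage_update_pi {ι : Type*} [DecidableEq ι] {X : ι → Type*} {s : Finset ι} {i : ι}
    (his : i ∈ s) (t : ∀ j, Set (X j)) :
    (fun p : (∀ j, X j) × X i => Function.update p.1 i p.2) ⁻¹' (s : Set ι).pi t =
      (s.erase i : Set ι).pi t ×ˢ t i := by
  ext p
  simp only [mem_preimage, Set.mem_pi, mem_prod, Finset.mem_coe, Finset.mem_erase]
  refine ⟨fun hp => ⟨fun j hj => ?_, by simpa using hp i his⟩, fun ⟨hp, hpi⟩ j hj => ?_⟩
  · simpa [Function.update_of_ne hj.1] using hp j hj.2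
  · rcases eq_or_ne j i with rfl | hji
    · simpa using hpi
    · simpa [Function.update_of_ne hji] using hp j ⟨hji, hj⟩

lemma preimage_update_pi_of_notMem {ι : Type*} [DecidableEq ι] {X : ι → Type*} {s : Set ι} {i : ι}
    (his : i ∉ s) (t : ∀ j, Set (X j)) :
    (fun p : (∀ j, X j) × X i => Function.update p.1 i p.2) ⁻¹' s.pi t = s.pi t ×ˢ univ := by
  ext p
  simp only [mem_preimage, Set.mem_pi, mem_prod, mem_univ, and_true]
  exact forall₂_congr fun j hj => by rw [Function.update_of_ne (ne_of_mem_of_not_mem hj his)]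

lemma map_update_infinitePi {ι : Type*} [DecidableEq ι] {X : ι → Type*}
    [∀ i, MeasurableSpace (X i)] (ν : ∀ i, Measure (X i)) [∀ i, IsProbabilityMeasure (ν i)]
    (i : ι) :
    ((Measure.infinitePi ν).prod (ν i)).map (fun p => Function.update p.1 i p.2) =
      Measure.infinitePi ν := by
  refine Measure.eq_infinitePi ν fun s t ht => ?_
  rw [Measure.map_apply measurable_update' (.pi s.countable_toSet fun j _ => ht j)]
  by_cases his : i ∈ s
  · rw [preimage_update_pi his, Measure.prod_prod, Measure.infinitePi_pi _ fun j _ => ht j,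
      mul_comm, Finset.mul_prod_erase s (fun j => ν j (t j)) his]
  · rw [preimage_update_pi_of_notMem (Finset.mem_coe.not.2 his), Measure.prod_prod,
      Measure.infinitePi_pi _ fun j _ => ht j, measure_univ, mul_one]

lemma IsPoissonArrivals.isGapLaw {I Ω : Type*} [DecidableEq I] [MeasurableSpace Ω]
    {μ : Measure Ω} [IsProbabilityMeasure μ] {rate : I → ℝ} {gap : I → ℕ → Ω → ℝ}
    (h : IsPoissonArrivals μ rate gap) (hrate : ∀ i, 0 < rate i) :
    IsGapLaw rate (μ.map fun ω a => gap a.1 a.2 ω) := by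
  have hm : ∀ a : I × ℕ, Measurable (gap a.1 a.2) := fun a => h.meas a.1 a.2
  have hprob : ∀ a : I × ℕ, IsProbabilityMeasure (expMeasure (rate a.1)) :=
    fun a => isProbabilityMeasure_expMeasure (hrate a.1)
  have hlaw : μ.map (fun ω (a : I × ℕ) => gap a.1 a.2 ω) =
      Measure.infinitePi fun a : I × ℕ => expMeasure (rate a.1) := by
    rw [h.indep.map_fun_eq_infinitePi_map hm]
    congr 1
    exact funext fun a => h.law a.1 a.2
  refine ⟨hrate, Measure.isProbabilityMeasure_map (measurable_pi_iff.2 hm).aemeasurable,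
    fun a => ?_⟩
  rw [hlaw]
  exact map_update_infinitePi (fun a : I × ℕ => expMeasure (rate a.1)) a

/-- `H g t` depends only on the arrivals before time `t`. -/
def IsPredictable {I β : Type*} (H : (I × ℕ → ℝ) → ℝ → β) : Prop :=
  ∀ g g' t, (∀ a, arrTime g a < t → arrTime g' a = arrTime g a) →
    (∀ a, arrTime g' a < t → arrTime g' a = arrTime g a) → H g t = H g' t

lemma IsPredictable.indicator {I β : Type*} [Zero β] {H : (I × ℕ → ℝ) → ℝ → β}
    (hpred : IsPredictable H) (s : Set ℝ) : IsPredictable fun g => s.indicator (H g) :=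
  fun g g' t h h' => by simp only [Set.indicator, hpred g g' t h h']

lemma measurable_uncurry_indicator {I β : Type*} [Zero β] [MeasurableSpace β]
    {H : (I × ℕ → ℝ) → ℝ → β} (hH : Measurable (Function.uncurry H)) {s : Set ℝ}
    (hs : MeasurableSet s) : Measurable (Function.uncurry fun g => s.indicator (H g)) :=
  hH.indicator (measurable_snd hs)

lemma measurable_comp_arrTime {I β : Type*} [MeasurableSpace β] {H : (I × ℕ → ℝ) → ℝ → β}
    (hH : Measurable (Function.uncurry H)) (a : I × ℕ) : Measurable fun g => H g (arrTime g a) :=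
  hH.comp (measurable_id.prodMk (measurable_arrTime a))

lemma measurable_setLIntegral_gap {I : Type*} {H : (I × ℕ → ℝ) → ℝ → ℝ≥0∞}
    (hH : Measurable (Function.uncurry H)) (a : I × ℕ) :
    Measurable fun g : I × ℕ → ℝ => ∫⁻ t in Ioo (prevTime g a) (arrTime g a), H g t := by
  have hset : MeasurableSet {p : (I × ℕ → ℝ) × ℝ | p.2 ∈ Ioo (prevTime p.1 a) (arrTime p.1 a)} :=
    (measurableSet_lt ((measurable_prevTime a).comp measurable_fst) measurable_snd).inter
      (measurableSet_lt measurable_snd ((measurable_arrTime a).comp measurable_fst))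
  simp only [← lintegral_indicator measurableSet_Ioo]
  exact (hH.indicator hset).lintegral_prod_right' (ν := (volume : Measure ℝ))

variable {I : Type*} [DecidableEq I] {lam : I → ℝ} {P : Measure (I × ℕ → ℝ)}
  {H : (I × ℕ → ℝ) → ℝ → ℝ≥0∞}

/-- Lengthening a gap does not affect the arrivals before its original end. -/
lemma IsPredictable.update_eq {β : Type*} {H : (I × ℕ → ℝ) → ℝ → β} (hH : IsPredictable H)
    {g : I × ℕ → ℝ} (hg : ∀ b, 0 < g b) (a : I × ℕ) {y z : ℝ} (hy : 0 < y) (hyz : y ≤ z) :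
    H (Function.update g a z) (prevTime g a + y) =
      H (Function.update g a y) (prevTime g a + y) := by
  have hearly : ∀ w, y ≤ w → ∀ b, arrTime (Function.update g a w) b < prevTime g a + y →
      b.1 ≠ a.1 ∨ b.2 < a.2 := by
    rintro w hyw ⟨i, k⟩ hb
    by_contra! ⟨rfl, hk⟩
    have hpos : ∀ b, 0 < Function.update g a w b :=
      (Function.forall_update_iff g fun _ c => 0 < c).2 ⟨hy.trans_le hyw, fun b _ => hg b⟩
    have hmono := (strictMono_arrTime hpos a.1).monotone hk
    dsimp only [Prod.mk.eta] at hmono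
    rw [arrTime_update_self] at hmono
    linarith
  have heq : ∀ b, b.1 ≠ a.1 ∨ b.2 < a.2 →
      arrTime (Function.update g a y) b = arrTime (Function.update g a z) b := fun b h => by
    rw [arrTime_update_of_ne _ _ h, arrTime_update_of_ne _ _ h]
  exact hH _ _ _ (fun b hb => heq b (hearly z hyz b hb)) fun b hb => heq b (hearly y le_rfl b hb)

namespace IsGapLaw

lemma lintegral_eq (hP : IsGapLaw lam P) (a : I × ℕ) {F : (I × ℕ → ℝ) → ℝ≥0∞}
    (hF : Measurable F) :
    ∫⁻ g, F g ∂P = ∫⁻ g, ∫⁻ y, F (Function.update g a y) ∂expMeasure (lam a.1) ∂P := by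
  have := hP.prob
  have := isProbabilityMeasure_expMeasure (hP.pos a.1)
  conv_lhs => rw [← hP.resample a]
  rw [lintegral_map hF measurable_update']
  exact lintegral_prod _ (hF.comp measurable_update').aemeasurable

lemma ae_of_ae_update (hP : IsGapLaw lam P) (a : I × ℕ) {p : (I × ℕ → ℝ) → Prop}
    (hp : MeasurableSet {g | p g})
    (h : ∀ g, ∀ᵐ y ∂expMeasure (lam a.1), p (Function.update g a y)) : ∀ᵐ g ∂P, p g := by
  have := hP.prob
  have := isProbabilityMeasure_expMeasure (hP.pos a.1)
  rw [← hP.resample a, ae_map_iff measurable_update'.aemeasurable hp]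
  exact (Measure.ae_prod_iff_ae_ae (measurable_update' hp)).2 (Filter.Eventually.of_forall h)

lemma ae_pos [Countable I] (hP : IsGapLaw lam P) : ∀ᵐ g ∂P, ∀ b, 0 < g b := by
  refine ae_all_iff.2 fun b => hP.ae_of_ae_update b
    (measurableSet_lt measurable_const (measurable_pi_apply b)) fun g => ?_
  filter_upwards [ae_pos_expMeasure (hP.pos b.1)] with y hy
  rwa [Function.update_self]

lemma ae_arrTime_ne (hP : IsGapLaw lam P) {a b : I × ℕ} (hab : a.1 ≠ b.1) :
    ∀ᵐ g ∂P, arrTime g a ≠ arrTime g b := by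
  refine hP.ae_of_ae_update a
    (measurableSet_eq_fun (measurable_arrTime a) (measurable_arrTime b)).compl fun g => ?_
  have hne : ∀ᵐ y ∂expMeasure (lam a.1), y ≠ arrTime g b - prevTime g a := by
    simpa [ae_iff] using expMeasure_singleton _
  filter_upwards [hne] with y hy
  rw [arrTime_update_self, arrTime_update_of_ne g y (Or.inl hab.symm)]
  exact fun h => hy (eq_sub_of_add_eq' h)

lemma ae_injective [Countable I] (hP : IsGapLaw lam P) :
    ∀ᵐ g ∂P, Function.Injective (arrTime g) := by
  have hne : ∀ᵐ g ∂P, ∀ a b : I × ℕ, a.1 ≠ b.1 → arrTime g a ≠ arrTime g b := by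
    simp only [ae_all_iff]
    exact fun a b => hP.ae_arrTime_ne
  filter_upwards [hne, hP.ae_pos] with g hg hpos
  rintro ⟨i, k⟩ ⟨i', k'⟩ hab
  obtain rfl : i = i' := not_imp_not.1 (hg (i, k) (i', k')) hab
  rw [(strictMono_arrTime hpos i).injective hab]

/-- Conditionally on the other gaps, this is the compensator identity for an exponential
waiting time. -/
lemma lintegral_arrTime [Countable I] (hP : IsGapLaw lam P)
    (hH : Measurable (Function.uncurry H)) (hpred : IsPredictable H) (a : I × ℕ) :
    ∫⁻ g, H g (arrTime g a) ∂P =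
      ENNReal.ofReal (lam a.1) * ∫⁻ g, (∫⁻ t in Ioo (prevTime g a) (arrTime g a), H g t) ∂P := by
  have := hP.prob
  have := isProbabilityMeasure_expMeasure (hP.pos a.1)
  rw [hP.lintegral_eq a (measurable_comp_arrTime hH a),
    hP.lintegral_eq a (measurable_setLIntegral_gap hH a),
    ← lintegral_const_mul' _ _ ENNReal.ofReal_ne_top]
  refine lintegral_congr_ae ?_
  filter_upwards [hP.ae_pos] with g hg
  have hupdate : Measurable fun y => H (Function.update g a y) (prevTime g a + y) :=
    hH.comp ((measurable_update g).prodMk (measurable_const.add measurable_id))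
  have hshift : ∀ z, ∫⁻ t in Ioo (prevTime g a) (prevTime g a + z), H (Function.update g a z) t =
      ∫⁻ y in Ioo 0 z, H (Function.update g a y) (prevTime g a + y) := fun z => by
    rw [← (measurePreserving_add_left volume (prevTime g a)).setLIntegral_comp_preimage_emb
      (measurableEmbedding_addLeft _), preimage_const_add_Ioo, sub_self, add_sub_cancel_left]
    exact setLIntegral_congr_fun measurableSet_Ioo fun y hy => hpred.update_eq hg a hy.1 hy.2.le
  simp only [arrTime_update_self, prevTime_update, hshift]
  exact lintegral_expMeasure_eq (hP.pos a.1) hupdate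

lemma lintegral_tsum_arrTime [Countable I] (hP : IsGapLaw lam P)
    (hH : Measurable (Function.uncurry H)) (hpred : IsPredictable H) (i : I) :
    ∫⁻ g, ∑' k, H g (arrTime g (i, k)) ∂P = ENNReal.ofReal (lam i) *
      ∫⁻ g, (∫⁻ t in ⋃ k, Ioo (prevTime g (i, k)) (arrTime g (i, k)), H g t) ∂P := by
  have hUnion : ∀ᵐ g ∂P, ∫⁻ t in ⋃ k, Ioo (prevTime g (i, k)) (arrTime g (i, k)), H g t =
      ∑' k, ∫⁻ t in Ioo (prevTime g (i, k)) (arrTime g (i, k)), H g t := by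
    filter_upwards [hP.ae_pos] with g hg
    exact lintegral_iUnion (fun _ => measurableSet_Ioo) (pairwise_disjoint_gap hg i) _
  rw [lintegral_tsum fun k => (measurable_comp_arrTime hH (i, k)).aemeasurable,
    lintegral_congr_ae hUnion,
    lintegral_tsum fun k => (measurable_setLIntegral_gap hH (i, k)).aemeasurable,
    ← ENNReal.tsum_mul_left]
  exact tsum_congr fun k => hP.lintegral_arrTime hH hpred (i, k)

lemma lintegral_count_le [Countable I] (hP : IsGapLaw lam P) (i : I) :
    ∫⁻ g, ∑' k, (Ioc (0 : ℝ) 1).indicator (fun _ => 1) (arrTime g (i, k)) ∂P ≤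
      ENNReal.ofReal (lam i) := by
  have := hP.prob
  have hone : IsPredictable fun (_ : I × ℕ → ℝ) (_ : ℝ) => (1 : ℝ≥0∞) := fun _ _ _ _ _ => rfl
  rw [hP.lintegral_tsum_arrTime (measurable_uncurry_indicator (H := fun _ _ => 1)
    measurable_const measurableSet_Ioc) (hone.indicator _)]
  calc _ ≤ ENNReal.ofReal (lam i) * ∫⁻ _, 1 ∂P := by
        gcongr with g
        refine (setLIntegral_le_lintegral _ _).trans ?_
        rw [lintegral_indicator measurableSet_Ioc]
        simp
    _ = _ := by rw [lintegral_one, measure_univ, mul_one]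

lemma ae_finite [Countable I] (hP : IsGapLaw lam P) :
    ∀ᵐ g ∂P, ∀ i, {k | arrTime g (i, k) ≤ 1}.Finite := by
  refine ae_all_iff.2 fun i => ?_
  have hcount : Measurable fun g : I × ℕ → ℝ =>
      ∑' k, (Ioc (0 : ℝ) 1).indicator (fun _ => (1 : ℝ≥0∞)) (arrTime g (i, k)) :=
    .tsum fun k => (measurable_const.indicator measurableSet_Ioc).comp (measurable_arrTime (i, k))
  filter_upwards [ae_lt_top hcount ((hP.lintegral_count_le i).trans_lt ENNReal.ofReal_lt_top).ne,
    hP.ae_pos] with g hg hpos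
  refine (ENNReal.finite_const_le_of_tsum_ne_top hg.ne one_ne_zero).subset fun k hk => ?_
  have hmem : arrTime g (i, k) ∈ Ioc (0 : ℝ) 1 := ⟨arrTime_pos hpos _, hk⟩
  exact (indicator_of_mem hmem fun _ => (1 : ℝ≥0∞)).ge

lemma campbell [Countable I] (hP : IsGapLaw lam P) (hH : Measurable (Function.uncurry H))
    (hpred : IsPredictable H) (i : I) :
    ∫⁻ g, ∑' k, (Ioc (0 : ℝ) 1).indicator (H g) (arrTime g (i, k)) ∂P =
      ENNReal.ofReal (lam i) * ∫⁻ g, (∫⁻ t in Ioc (0 : ℝ) 1, H g t) ∂P := by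
  rw [hP.lintegral_tsum_arrTime (measurable_uncurry_indicator hH measurableSet_Ioc)
    (hpred.indicator _)]
  congr 1
  refine lintegral_congr_ae ?_
  filter_upwards [hP.ae_finite] with g hfin
  have hcover : ∀ᵐ t : ℝ, t ∈ Ioc (0 : ℝ) 1 →
      t ∈ ⋃ k, Ioo (prevTime g (i, k)) (arrTime g (i, k)) := by
    filter_upwards [(countable_range fun k => arrTime g (i, k)).ae_notMem volume] with t ht ht1
    obtain ⟨k, hk⟩ := (hfin i).exists_notMem
    exact mem_iUnion_gap ht1.1 ⟨k, ht1.2.trans_lt (not_le.1 hk)⟩ fun k hk => ht ⟨k, hk⟩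
  rw [← lintegral_indicator (.iUnion fun _ => measurableSet_Ioo), indicator_indicator,
    ← lintegral_indicator measurableSet_Ioc]
  refine lintegral_congr_ae ?_
  filter_upwards [hcover] with t ht
  by_cases ht1 : t ∈ Ioc (0 : ℝ) 1
  · rw [indicator_of_mem (mem_inter (ht ht1) ht1), indicator_of_mem ht1]
  · rw [indicator_of_notMem fun h => ht1 h.2, indicator_of_notMem ht1]

end IsGapLaw

end GapLaw

/-! ### Processing points in order of time -/

section Orderings

variable {α Q : Type*}

/-- The list `l` enumerates the set `s` in strictly increasing order of the times `τ`. -/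
def IsOrdering (τ : α → ℝ) (s : Set α) (l : List α) : Prop :=
  l.Pairwise (fun a b => τ a < τ b) ∧ ∀ a, a ∈ l ↔ a ∈ s

lemma IsOrdering.nodup {τ : α → ℝ} {s : Set α} {l : List α} (h : IsOrdering τ s l) : l.Nodup :=
  h.1.imp fun hab heq => by simp [heq] at hab

lemma IsOrdering.unique {τ : α → ℝ} {s : Set α} {l l' : List α} (h : IsOrdering τ s l)
    (h' : IsOrdering τ s l') : l = l' := by
  have hperm : l.Perm l' := (List.perm_ext_iff_of_nodup h.nodup h'.nodup).2 fun a =>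
    (h.2 a).trans (h'.2 a).symm
  exact hperm.eq_of_pairwise (fun a b _ _ hab hba => absurd hab hba.not_gt) h.1 h'.1

lemma IsOrdering.congr {τ τ' : α → ℝ} {s : Set α} {l : List α} (h : IsOrdering τ s l)
    (hτ : ∀ a ∈ s, τ' a = τ a) : IsOrdering τ' s l := by
  refine ⟨h.1.imp_of_mem fun {a b} ha hb hab => ?_, h.2⟩
  rwa [hτ a ((h.2 a).1 ha), hτ b ((h.2 b).1 hb)]

lemma IsOrdering.filter_lt {τ : α → ℝ} {c t : ℝ} {l : List α} (h : IsOrdering τ {a | τ a ≤ c} l)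
    (ht : t ≤ c) : IsOrdering τ {a | τ a < t} (l.filter fun a => decide (τ a < t)) := by
  refine ⟨h.1.filter _, fun a => ?_⟩
  rw [List.mem_filter, h.2, decide_eq_true_iff]
  exact ⟨fun ha => ha.2, fun ha => ⟨(lt_of_lt_of_le ha ht).le, ha⟩⟩

/-- The state reached from `q` when the points of `l`, with times `τ`, are processed one after
the other; `K a t` is the update of the state by a point `a` at time `t`. -/
def runList (K : α → ℝ → Q → Q) (τ : α → ℝ) (q : Q) (l : List α) : Q :=
  l.foldl (fun q a => K a (τ a) q) q

lemma runList_congr {K : α → ℝ → Q → Q} {τ τ' : α → ℝ} {l : List α} (h : ∀ a ∈ l, τ' a = τ a)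
    (q : Q) : runList K τ' q l = runList K τ q l :=
  List.foldl_ext _ _ q fun q a ha => by rw [h a ha]

open Classical in
/-- The state reached from `q₀` when the points of the set `s` are processed in order of time.
If `s` cannot be listed in order of time, the value is `q₀`. -/
def stateOn (K : α → ℝ → Q → Q) (q₀ : Q) (τ : α → ℝ) (s : Set α) : Q :=
  if h : ∃ l, IsOrdering τ s l then runList K τ q₀ h.choose else q₀

lemma IsOrdering.stateOn_eq {K : α → ℝ → Q → Q} {q₀ : Q} {τ : α → ℝ} {s : Set α} {l : List α}
    (h : IsOrdering τ s l) : stateOn K q₀ τ s = runList K τ q₀ l := by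
  have hex : ∃ l, IsOrdering τ s l := ⟨l, h⟩
  rw [stateOn, dif_pos hex, hex.choose_spec.unique h]

lemma stateOn_eq_of_not_exists {K : α → ℝ → Q → Q} {q₀ : Q} {τ : α → ℝ} {s : Set α}
    (h : ¬∃ l, IsOrdering τ s l) : stateOn K q₀ τ s = q₀ :=
  dif_neg h

lemma stateOn_eq_iff {K : α → ℝ → Q → Q} {q₀ q : Q} {τ : α → ℝ} {s : Set α} :
    stateOn K q₀ τ s = q ↔
      (∃ l, IsOrdering τ s l ∧ runList K τ q₀ l = q) ∨ (¬∃ l, IsOrdering τ s l) ∧ q₀ = q := by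
  by_cases hex : ∃ l, IsOrdering τ s l
  · obtain ⟨l, hl⟩ := hex
    have hunique : (∃ l', IsOrdering τ s l' ∧ runList K τ q₀ l' = q) ↔ runList K τ q₀ l = q :=
      ⟨fun ⟨l', hl', hq⟩ => hl.unique hl' ▸ hq, fun hq => ⟨l, hl, hq⟩⟩
    rw [hl.stateOn_eq, hunique]
    exact ⟨Or.inl, fun h => h.resolve_right fun h' => h'.1 ⟨l, hl⟩⟩
  · rw [stateOn_eq_of_not_exists hex]
    exact ⟨fun hq => Or.inr ⟨hex, hq⟩,
      fun h => (h.resolve_left fun ⟨l, hl, _⟩ => hex ⟨l, hl⟩).2⟩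

lemma stateOn_congr {K : α → ℝ → Q → Q} {q₀ : Q} {τ τ' : α → ℝ} {s : Set α}
    (h : ∀ a ∈ s, τ' a = τ a) : stateOn K q₀ τ' s = stateOn K q₀ τ s := by
  by_cases hex : ∃ l, IsOrdering τ s l
  · obtain ⟨l, hl⟩ := hex
    rw [hl.stateOn_eq, (hl.congr h).stateOn_eq]
    exact runList_congr (fun a ha => h a ((hl.2 a).1 ha)) _
  · have hex' : ¬∃ l, IsOrdering τ' s l := fun ⟨l, hl⟩ =>
      hex ⟨l, hl.congr fun a ha => (h a ha).symm⟩
    rw [stateOn_eq_of_not_exists hex, stateOn_eq_of_not_exists hex']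

variable {X : Type*} [MeasurableSpace X]

lemma measurableSet_isOrdering [Countable α] {τ : X → α → ℝ}
    (hτ : ∀ a, Measurable fun x => τ x a) {s : X → Set α}
    (hs : ∀ a, MeasurableSet {x | a ∈ s x}) (l : List α) :
    MeasurableSet {x | IsOrdering (τ x) (s x) l} := by
  simp only [IsOrdering, List.pairwise_iff_getElem]
  refine measurableSet_setOfPred.2 (.and ?_ ?_)
  · exact .forall fun i => .forall fun j => .forall fun hi => .forall fun hj => .forall fun _ =>
      measurableSet_setOfPred.1 (measurableSet_lt (hτ _) (hτ _))
  · exact .forall fun a => measurable_const.iff (measurableSet_setOfPred.1 (hs a))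

variable [Countable Q] [MeasurableSpace Q] [MeasurableSingletonClass Q]

lemma measurable_runList {K : α → ℝ → Q → Q} (hK : ∀ a q, Measurable fun t => K a t q)
    {τ : X → α → ℝ} (hτ : ∀ a, Measurable fun x => τ x a) (l : List α) {q : X → Q}
    (hq : Measurable q) : Measurable fun x => runList K (τ x) (q x) l := by
  induction l generalizing q with
  | nil => exact hq
  | cons a _ ih =>
    have hKa : Measurable fun p : ℝ × Q => K a p.1 p.2 :=
      measurable_from_prod_countable_left (hK a)
    exact ih (hKa.comp ((hτ a).prodMk hq))

lemma measurable_stateOn [Countable α] {K : α → ℝ → Q → Q}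
    (hK : ∀ a q, Measurable fun t => K a t q) (q₀ : Q) {τ : X → α → ℝ}
    (hτ : ∀ a, Measurable fun x => τ x a) {s : X → Set α}
    (hs : ∀ a, MeasurableSet {x | a ∈ s x}) : Measurable fun x => stateOn K q₀ (τ x) (s x) := by
  refine measurable_to_countable' fun q => ?_
  have hpre : (fun x => stateOn K q₀ (τ x) (s x)) ⁻¹' {q} =
      {x | (∃ l, IsOrdering (τ x) (s x) l ∧ runList K (τ x) q₀ l = q) ∨
        (¬∃ l, IsOrdering (τ x) (s x) l) ∧ q₀ = q} := by
    ext x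
    exact stateOn_eq_iff
  have hord := fun l => measurableSet_setOfPred.1 (measurableSet_isOrdering hτ hs l)
  have hrun := fun l => measurableSet_setOfPred.1
    (measurable_runList hK hτ l measurable_const (measurableSet_singleton q) :
      MeasurableSet {x | runList K (τ x) q₀ l = q})
  rw [hpre]
  exact measurableSet_setOfPred.2 (.or (.exists fun l => (hord l).and (hrun l))
    ((Measurable.exists hord).not.and measurable_const))

end Orderings

section Telescoping

variable {α Q : Type*}

/-- The state just before time `t` when the points of `l` are processed starting from `q`: only
the points with time less than `t` have been processed. -/
def runBefore (K : α → ℝ → Q → Q) (τ : α → ℝ) (q : Q) (l : List α) (t : ℝ) : Q :=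
  runList K τ q (l.filter fun a => decide (τ a < t))

lemma runBefore_eq_of_le (K : α → ℝ → Q → Q) {τ : α → ℝ} (q : Q) {l : List α} {t : ℝ}
    (h : ∀ a ∈ l, t ≤ τ a) : runBefore K τ q l t = q := by
  have hnil : l.filter (fun a => decide (τ a < t)) = [] := by simpa using h
  rw [runBefore, hnil]
  rfl

lemma runBefore_cons_of_lt (K : α → ℝ → Q → Q) {τ : α → ℝ} (q : Q) {a : α} (l : List α) {t : ℝ}
    (h : τ a < t) : runBefore K τ q (a :: l) t = runBefore K τ (K a (τ a) q) l t := by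
  rw [runBefore, List.filter_cons_of_pos (by simpa using h)]
  rfl

lemma runBefore_cons_of_le (K : α → ℝ → Q → Q) {τ : α → ℝ} (q : Q) {a : α} {l : List α} {t : ℝ}
    (hl : ∀ b ∈ l, τ a < τ b) (h : t ≤ τ a) : runBefore K τ q (a :: l) t = q :=
  runBefore_eq_of_le K q (List.forall_mem_cons.2 ⟨h, fun b hb => h.trans (hl b hb).le⟩)

lemma integral_runBefore_cons (K : α → ℝ → Q → Q) {τ : α → ℝ} {f : ℝ → Q → ℝ} {s u : ℝ} {q : Q}
    {a : α} {l : List α} (hl : ∀ b ∈ l, τ a < τ b) (hs : s ≤ τ a) (hu : τ a ≤ u)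
    (hhead : IntervalIntegrable (fun t => f t q) volume s (τ a))
    (htail : IntervalIntegrable (fun t => f t (runBefore K τ (K a (τ a) q) l t)) volume (τ a) u) :
    IntervalIntegrable (fun t => f t (runBefore K τ q (a :: l) t)) volume s u ∧
    ∫ t in s..u, f t (runBefore K τ q (a :: l) t) =
      (∫ t in s..τ a, f t q) + ∫ t in τ a..u, f t (runBefore K τ (K a (τ a) q) l t) := by
  have hcongr_head : EqOn (fun t => f t q) (fun t => f t (runBefore K τ q (a :: l) t))
      (uIoc s (τ a)) := fun t ht => by
    rw [uIoc_of_le hs] at ht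
    simp only [runBefore_cons_of_le K q hl ht.2]
  have hcongr_tail : EqOn (fun t => f t (runBefore K τ (K a (τ a) q) l t))
      (fun t => f t (runBefore K τ q (a :: l) t)) (uIoc (τ a) u) := fun t ht => by
    rw [uIoc_of_le hu] at ht
    simp only [runBefore_cons_of_lt K q l ht.1]
  replace hhead := (intervalIntegrable_congr (μ := volume) hcongr_head).1 hhead
  replace htail := (intervalIntegrable_congr hcongr_tail).1 htail
  refine ⟨hhead.trans htail, ?_⟩
  rw [← intervalIntegral.integral_add_adjacent_intervals hhead htail,
    intervalIntegral.integral_congr_ae (.of_forall hcongr_head),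
    intervalIntegral.integral_congr_ae (.of_forall hcongr_tail)]

lemma sub_eq_sum_jumps_add_integral (K : α → ℝ → Q → Q) (τ : α → ℝ) {F F' : ℝ → Q → ℝ}
    (hF : ∀ t q, HasDerivAt (fun t => F t q) (F' t q) t) (hF' : ∀ q, Continuous fun t => F' t q)
    (l : List α) (s u : ℝ) (q : Q) (hl : l.Pairwise fun a b => τ a < τ b)
    (hs : ∀ a ∈ l, s < τ a ∧ τ a ≤ u) :
    IntervalIntegrable (fun t => F' t (runBefore K τ q l t)) volume s u ∧
    F u (runList K τ q l) - F s q =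
      (l.map fun a => F (τ a) (K a (τ a) (runBefore K τ q l (τ a))) -
        F (τ a) (runBefore K τ q l (τ a))).sum +
      ∫ t in s..u, F' t (runBefore K τ q l t) := by
  induction l generalizing s q with
  | nil =>
    exact ⟨(hF' q).intervalIntegrable _ _, by
      simpa [runBefore, runList] using (intervalIntegral.integral_eq_sub_of_hasDerivAt
        (fun t _ => hF t q) ((hF' q).intervalIntegrable s u)).symm⟩
  | cons a l ih =>
    rw [List.pairwise_cons] at hl
    obtain ⟨hsa, hau⟩ := hs a List.mem_cons_self
    obtain ⟨hint_tail, heq_tail⟩ := ih (τ a) (K a (τ a) q) hl.2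
      fun b hb => ⟨hl.1 b hb, (hs b (List.mem_cons_of_mem _ hb)).2⟩
    have hint_head := (hF' q).intervalIntegrable (μ := volume) s (τ a)
    obtain ⟨hint, hsplit⟩ := integral_runBefore_cons K hl.1 hsa.le hau hint_head hint_tail
    refine ⟨hint, ?_⟩
    rw [hsplit, intervalIntegral.integral_eq_sub_of_hasDerivAt (fun t _ => hF t q) hint_head,
      List.map_cons, List.sum_cons, runBefore_cons_of_le K q hl.1 le_rfl,
      List.map_congr_left fun b hb => by rw [runBefore_cons_of_lt K q l (hl.1 b hb)]]
    have hcons : runList K τ q (a :: l) = runList K τ (K a (τ a) q) l := rfl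
    rw [hcons]
    linarith

end Telescoping

/-! ### Processes driven by Poisson arrivals -/

section ArrivalSums

variable {I : Type*} {g : I × ℕ → ℝ} {i : I}

/-- The sum of the values of `f` at the arrival times of type `i` in `(0, 1]`. -/
def arrivalSum (f : ℝ → ℝ) (g : I × ℕ → ℝ) (i : I) : ℝ :=
  ∑' k, (Ioc (0 : ℝ) 1).indicator f (arrTime g (i, k))

lemma summable_indicator_arrTime (hfin : {k | arrTime g (i, k) ≤ 1}.Finite) (f : ℝ → ℝ) :
    Summable fun k => (Ioc (0 : ℝ) 1).indicator f (arrTime g (i, k)) := by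
  refine summable_of_hasFiniteSupport (hfin.subset fun k hk => ?_)
  by_contra hlate
  exact hk (indicator_of_notMem (fun hmem => hlate hmem.2) _)

lemma arrivalSum_nonneg {f : ℝ → ℝ} (hf : ∀ t, 0 ≤ f t) (g : I × ℕ → ℝ) (i : I) :
    0 ≤ arrivalSum f g i :=
  tsum_nonneg fun _ => indicator_nonneg (fun t _ => hf t) _

lemma arrivalSum_sub (hfin : {k | arrTime g (i, k) ≤ 1}.Finite) (f f' : ℝ → ℝ) :
    arrivalSum (fun t => f t - f' t) g i = arrivalSum f g i - arrivalSum f' g i := by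
  rw [arrivalSum, arrivalSum, arrivalSum, ← (summable_indicator_arrTime hfin f).tsum_sub
    (summable_indicator_arrTime hfin f')]
  exact tsum_congr fun k => congrFun (indicator_sub (Ioc (0 : ℝ) 1) f f') _

lemma ofReal_arrivalSum (hfin : {k | arrTime g (i, k) ≤ 1}.Finite) {f : ℝ → ℝ}
    (hf : ∀ t, 0 ≤ f t) :
    ENNReal.ofReal (arrivalSum f g i) =
      ∑' k, (Ioc (0 : ℝ) 1).indicator (fun t => ENNReal.ofReal (f t)) (arrTime g (i, k)) := by
  rw [arrivalSum, ENNReal.ofReal_tsum_of_nonneg (fun _ => indicator_nonneg (fun t _ => hf t) _)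
    (summable_indicator_arrTime hfin f)]
  refine tsum_congr fun k => ?_
  by_cases hk : arrTime g (i, k) ∈ Ioc (0 : ℝ) 1 <;> simp [indicator, hk]

lemma measurable_arrivalSum {h : (I × ℕ → ℝ) → ℝ → ℝ} (hm : Measurable (Function.uncurry h))
    (i : I) : Measurable fun g => arrivalSum (h g) g i :=
  .tsum fun k => measurable_comp_arrTime (measurable_uncurry_indicator hm measurableSet_Ioc) (i, k)

lemma sum_arrivalSum_eq [Fintype I] (hg : ∀ a, 0 < g a) {l : List (I × ℕ)}
    (hl : IsOrdering (arrTime g) {a | arrTime g a ≤ 1} l) (f : I → ℝ → ℝ) :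
    ∑ i, arrivalSum (f i) g i = (l.map fun a => f a.1 (arrTime g a)).sum := by
  classical
  have hmem : ∀ a ∈ l, arrTime g a ∈ Ioc (0 : ℝ) 1 := fun a ha =>
    ⟨arrTime_pos hg a, (hl.2 a).1 ha⟩
  have hzero : ∀ a ∉ l.toFinset, (Ioc (0 : ℝ) 1).indicator (f a.1) (arrTime g a) = 0 :=
    fun a ha => indicator_of_notMem
      (fun hIoc => ha (List.mem_toFinset.2 ((hl.2 a).2 hIoc.2))) _
  have hsummable : Summable fun a : I × ℕ => (Ioc (0 : ℝ) 1).indicator (f a.1) (arrTime g a) :=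
    summable_of_ne_finset_zero hzero
  simp only [arrivalSum]
  rw [← tsum_fintype (L := .unconditional I), ← hsummable.tsum_prod, tsum_eq_sum hzero,
    List.sum_toFinset _ hl.nodup]
  exact congrArg List.sum (List.map_congr_left fun a ha => indicator_of_mem (hmem a ha) _)

end ArrivalSums

section Campbell

variable {I : Type*} [DecidableEq I] [Countable I] {lam : I → ℝ} {P : Measure (I × ℕ → ℝ)}
  {h : (I × ℕ → ℝ) → ℝ → ℝ}

lemma IsPredictable.comp {I Q β : Type*} {H : (I × ℕ → ℝ) → ℝ → Q} (hH : IsPredictable H)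
    (f : ℝ → Q → β) : IsPredictable fun g t => f t (H g t) :=
  fun g g' t hg hg' => congrArg (f t) (hH g g' t hg hg')

lemma IsGapLaw.campbell_of_nonneg (hP : IsGapLaw lam P) (hm : Measurable (Function.uncurry h))
    (hint : Integrable (Function.uncurry h) (P.prod (volume.restrict (Ioc (0 : ℝ) 1))))
    (hpred : IsPredictable h) (h0 : ∀ g t, 0 ≤ h g t) (i : I) :
    Integrable (fun g => arrivalSum (h g) g i) P ∧
      ∫ g, arrivalSum (h g) g i ∂P =
        lam i * ∫ p, h p.1 p.2 ∂P.prod (volume.restrict (Ioc (0 : ℝ) 1)) := by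
  have := hP.prob
  have hsum0 : 0 ≤ᵐ[P] fun g => arrivalSum (h g) g i :=
    .of_forall fun g => arrivalSum_nonneg (h0 g) g i
  have hsum_meas := (measurable_arrivalSum hm i).aestronglyMeasurable (μ := P)
  have hlint : ∫⁻ g, ENNReal.ofReal (arrivalSum (h g) g i) ∂P = ENNReal.ofReal
      (lam i * ∫ p, h p.1 p.2 ∂P.prod (volume.restrict (Ioc (0 : ℝ) 1))) := by
    calc ∫⁻ g, ENNReal.ofReal (arrivalSum (h g) g i) ∂P
        = ∫⁻ g, ∑' k, (Ioc (0 : ℝ) 1).indicator (fun t => ENNReal.ofReal (h g t))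
            (arrTime g (i, k)) ∂P :=
          lintegral_congr_ae (hP.ae_finite.mono fun g hfin => ofReal_arrivalSum (hfin i) (h0 g))
      _ = ENNReal.ofReal (lam i) * ∫⁻ g, (∫⁻ t in Ioc (0 : ℝ) 1, ENNReal.ofReal (h g t)) ∂P :=
          hP.campbell (H := fun g t => ENNReal.ofReal (h g t)) hm.ennreal_ofReal
            (hpred.comp fun _ => ENNReal.ofReal) i
      _ = ENNReal.ofReal (lam i) *
            ∫⁻ p, ENNReal.ofReal (h p.1 p.2) ∂P.prod (volume.restrict (Ioc (0 : ℝ) 1)) :=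
          congrArg _ (lintegral_prod _ hm.ennreal_ofReal.aemeasurable).symm
      _ = _ := by
          rw [ENNReal.ofReal_mul (hP.pos i).le]
          exact congrArg _ (ofReal_integral_eq_lintegral_ofReal hint
            (.of_forall fun p => h0 p.1 p.2)).symm
  refine ⟨⟨hsum_meas, ?_⟩, ?_⟩
  · rw [hasFiniteIntegral_iff_ofReal hsum0, hlint]
    exact ENNReal.ofReal_lt_top
  · rw [integral_eq_lintegral_of_nonneg_ae hsum0 hsum_meas, hlint]
    exact ENNReal.toReal_ofReal (mul_nonneg (hP.pos i).le (integral_nonneg fun p => h0 p.1 p.2))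

lemma IsGapLaw.campbell_of_integrable (hP : IsGapLaw lam P)
    (hm : Measurable (Function.uncurry h))
    (hint : Integrable (Function.uncurry h) (P.prod (volume.restrict (Ioc (0 : ℝ) 1))))
    (hpred : IsPredictable h) (i : I) :
    Integrable (fun g => arrivalSum (h g) g i) P ∧
      ∫ g, arrivalSum (h g) g i ∂P =
        lam i * ∫ p, h p.1 p.2 ∂P.prod (volume.restrict (Ioc (0 : ℝ) 1)) := by
  obtain ⟨hint_pos, heq_pos⟩ := hP.campbell_of_nonneg (h := fun g t => max (h g t) 0)
    (hm.max measurable_const) hint.pos_part (hpred.comp fun _ y => max y 0)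
    (fun _ _ => le_max_right _ _) i
  obtain ⟨hint_neg, heq_neg⟩ := hP.campbell_of_nonneg (h := fun g t => max (-h g t) 0)
    (hm.neg.max measurable_const) hint.neg_part (hpred.comp fun _ y => max (-y) 0)
    (fun _ _ => le_max_right _ _) i
  have hsplit : ∀ y : ℝ, y = max y 0 - max (-y) 0 := fun y => (posPart_sub_negPart y).symm
  have hsum : (fun g => arrivalSum (h g) g i) =ᵐ[P] fun g =>
      arrivalSum (fun t => max (h g t) 0) g i - arrivalSum (fun t => max (-h g t) 0) g i := by
    filter_upwards [hP.ae_finite] with g hfin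
    rw [← arrivalSum_sub (hfin i)]
    exact congrArg (arrivalSum · g i) (funext fun t => hsplit (h g t))
  refine ⟨(hint_pos.sub hint_neg).congr hsum.symm, ?_⟩
  rw [integral_congr_ae hsum, integral_sub hint_pos hint_neg, heq_pos, heq_neg, ← mul_sub]
  exact congrArg _ ((integral_sub hint.pos_part hint.neg_part).symm.trans
    (integral_congr_ae (.of_forall fun p => (hsplit (h p.1 p.2)).symm)))

end Campbell

section Trajectories

variable {I : Type*}

lemma finite_arrTime_le_one [Finite I] {g : I × ℕ → ℝ}
    (hfin : ∀ i, {k | arrTime g (i, k) ≤ 1}.Finite) : {a | arrTime g a ≤ 1}.Finite :=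
  (finite_iUnion fun i => (hfin i).image fun k => (i, k)).subset fun a ha =>
    mem_iUnion.2 ⟨a.1, a.2, ha, rfl⟩

lemma mem_arrivals {τ : I × ℕ → ℝ} (hfin : {a | τ a ≤ 1}.Finite) (a : I × ℕ) :
    a ∈ arrivals τ ↔ τ a ≤ 1 := by
  rw [arrivals, dif_pos hfin, hfin.mem_toFinset]
  rfl

lemma isOrdering_arrivalOrder {τ : I × ℕ → ℝ} (hinj : Function.Injective τ)
    (hfin : {a | τ a ≤ 1}.Finite) : IsOrdering τ {a | τ a ≤ 1} (arrivalOrder τ) := by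
  refine ⟨?_, fun a => ?_⟩
  · have hsorted : (arrivalOrder τ).Pairwise fun a b => decide (τ a ≤ τ b) = true :=
      List.pairwise_mergeSort (fun a b c hab hbc => by
        rw [decide_eq_true_iff] at *
        exact hab.trans hbc) (fun a b => by simpa using le_total (τ a) (τ b)) _
    have hnodup : (arrivalOrder τ).Nodup :=
      (List.mergeSort_perm _ _).nodup_iff.2 (Finset.nodup_toList _)
    exact (hsorted.and hnodup).imp fun hab =>
      lt_of_le_of_ne (of_decide_eq_true hab.1) fun heq => hab.2 (hinj heq)
  · rw [arrivalOrder, List.mem_mergeSort, Finset.mem_toList, mem_arrivals hfin]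
    rfl

variable {Q : Type*}

/-- The state just before time `t` when arrivals of type `i` at time `t` update it by `K i t`. -/
def stateBefore (K : I → ℝ → Q → Q) (q₀ : Q) (g : I × ℕ → ℝ) (t : ℝ) : Q :=
  stateOn (fun a => K a.1) q₀ (arrTime g) {a | arrTime g a < t}

lemma measurable_stateBefore [Countable I] [Countable Q] [MeasurableSpace Q]
    [MeasurableSingletonClass Q] {K : I → ℝ → Q → Q} (hK : ∀ i q, Measurable fun t => K i t q)
    (q₀ : Q) : Measurable (Function.uncurry (stateBefore K q₀)) :=
  measurable_stateOn (K := fun a : I × ℕ => K a.1) (fun a q => hK a.1 q) q₀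
    (τ := fun p : (I × ℕ → ℝ) × ℝ => arrTime p.1) (s := fun p => {a | arrTime p.1 a < p.2})
    (fun a => (measurable_arrTime a).comp measurable_fst)
    fun a => measurableSet_lt ((measurable_arrTime a).comp measurable_fst) measurable_snd

lemma isPredictable_stateBefore (K : I → ℝ → Q → Q) (q₀ : Q) :
    IsPredictable (stateBefore K q₀) := by
  intro g g' t hg hg'
  have hset : {a | arrTime g' a < t} = {a | arrTime g a < t} :=
    Subset.antisymm (fun a ha => (hg' a ha).symm.trans_lt ha) fun a ha => (hg a ha).trans_lt ha
  rw [stateBefore, stateBefore, hset]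
  exact (stateOn_congr hg).symm

lemma apply_terminal_eq [Fintype I] {g : I × ℕ → ℝ} (hg : ∀ a, 0 < g a)
    {l : List (I × ℕ)} (hl : IsOrdering (arrTime g) {a | arrTime g a ≤ 1} l)
    (K : I → ℝ → Q → Q) (q₀ : Q) {F F' : ℝ → Q → ℝ}
    (hF : ∀ t q, HasDerivAt (fun t => F t q) (F' t q) t)
    (hF' : ∀ q, Continuous fun t => F' t q) :
    F 1 (runList (fun a => K a.1) (arrTime g) q₀ l) = F 0 q₀ +
      (∑ i, arrivalSum (fun t => F t (K i t (stateBefore K q₀ g t)) -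
          F t (stateBefore K q₀ g t)) g i +
        ∫ t in Ioc (0 : ℝ) 1, F' t (stateBefore K q₀ g t)) := by
  have hstate : ∀ t ≤ 1, stateBefore K q₀ g t =
      runBefore (fun a => K a.1) (arrTime g) q₀ l t := fun t ht => (hl.filter_lt ht).stateOn_eq
  have hintegral : ∫ t in Ioc (0 : ℝ) 1, F' t (stateBefore K q₀ g t) =
      ∫ t in (0 : ℝ)..1, F' t (runBefore (fun a => K a.1) (arrTime g) q₀ l t) := by
    rw [intervalIntegral.integral_of_le zero_le_one]
    exact setIntegral_congr_fun measurableSet_Ioc fun t ht => by simp only [hstate t ht.2]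
  rw [sum_arrivalSum_eq hg hl, hintegral,
    List.map_congr_left fun a ha => by rw [hstate _ ((hl.2 a).1 ha)]]
  exact sub_eq_iff_eq_add'.1 (sub_eq_sum_jumps_add_integral (fun a : I × ℕ => K a.1) (arrTime g)
    hF hF' l 0 1 q₀ hl.1 fun a ha => ⟨arrTime_pos hg a, (hl.2 a).1 ha⟩).2

end Trajectories

section Drift

variable {I : Type*} {P : Measure (I × ℕ → ℝ)} {Q : Type*} [Finite Q]

lemma exists_abs_le_on_Icc {f : ℝ → Q → ℝ} (hf : ∀ q, Continuous fun t => f t q) :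
    ∃ C, ∀ t ∈ Icc (0 : ℝ) 1, ∀ q, |f t q| ≤ C := by
  have := Fintype.ofFinite Q
  choose C hC using fun q =>
    isCompact_Icc.exists_bound_of_continuousOn (hf q).continuousOn (s := Icc (0 : ℝ) 1)
  have hC0 : ∀ q, 0 ≤ C q := fun q => (norm_nonneg _).trans (hC q 0 (by simp))
  exact ⟨∑ q, C q, fun t ht q =>
    (hC q t ht).trans (Finset.single_le_sum (fun q _ => hC0 q) (Finset.mem_univ q))⟩

lemma integrable_uncurry_of_bdd [IsFiniteMeasure P] {h : (I × ℕ → ℝ) → ℝ → ℝ}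
    (hm : Measurable (Function.uncurry h)) {C : ℝ}
    (hC : ∀ g, ∀ t ∈ Icc (0 : ℝ) 1, |h g t| ≤ C) :
    Integrable (Function.uncurry h) (P.prod (volume.restrict (Ioc (0 : ℝ) 1))) := by
  refine .of_bound hm.aestronglyMeasurable C ?_
  filter_upwards [Measure.quasiMeasurePreserving_snd.ae (ae_restrict_mem measurableSet_Ioc)]
    with p hp
  exact hC p.1 p.2 (Ioc_subset_Icc_self hp)

variable [DecidableEq I] {lam : I → ℝ}

lemma IsGapLaw.integrable_terminal [Finite I] [MeasurableSpace Q]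
    [MeasurableSingletonClass Q] (hP : IsGapLaw lam P) {K : I → ℝ → Q → Q}
    (hK : ∀ i q, Measurable fun t => K i t q) (q₀ : Q) (F : Q → ℝ) :
    Integrable (fun g => F (runList (fun a => K a.1) (arrTime g) q₀ (arrivalOrder (arrTime g))))
      P := by
  have := hP.prob
  have hmeas : Measurable fun g : I × ℕ → ℝ =>
      stateOn (fun a => K a.1) q₀ (arrTime g) {a | arrTime g a ≤ 1} :=
    measurable_stateOn (fun a q => hK a.1 q) q₀ measurable_arrTime
      fun a => measurableSet_le (measurable_arrTime a) measurable_const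
  refine ((Integrable.of_finite (f := F)).comp_measurable hmeas).congr ?_
  filter_upwards [hP.ae_injective, hP.ae_finite] with g hinj hfin
  exact congrArg F (isOrdering_arrivalOrder hinj (finite_arrTime_le_one hfin)).stateOn_eq

variable [Fintype I]

lemma IsGapLaw.integral_sum_arrivalSum_add (hP : IsGapLaw lam P)
    {h : I → (I × ℕ → ℝ) → ℝ → ℝ} (hm : ∀ i, Measurable (Function.uncurry (h i)))
    (hint : ∀ i, Integrable (Function.uncurry (h i)) (P.prod (volume.restrict (Ioc (0 : ℝ) 1))))
    (hpred : ∀ i, IsPredictable (h i)) {d : (I × ℕ → ℝ) → ℝ → ℝ}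
    (hd : Integrable (Function.uncurry d) (P.prod (volume.restrict (Ioc (0 : ℝ) 1)))) (c : ℝ) :
    ∫ g, (c + (∑ i, arrivalSum (h i g) g i + ∫ t in Ioc (0 : ℝ) 1, d g t)) ∂P =
      c + ∫ p, (d p.1 p.2 + ∑ i, lam i * h i p.1 p.2)
        ∂P.prod (volume.restrict (Ioc (0 : ℝ) 1)) := by
  have := hP.prob
  have hcampbell := fun i => hP.campbell_of_integrable (hm i) (hint i) (hpred i) i
  have hsum_int : Integrable (fun g => ∑ i, arrivalSum (h i g) g i) P :=
    integrable_finsetSum _ fun i _ => (hcampbell i).1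
  have hd_int : Integrable (fun g => ∫ t in Ioc (0 : ℝ) 1, d g t) P := hd.integral_prod_left
  have hd_prod : ∫ g, (∫ t in Ioc (0 : ℝ) 1, d g t) ∂P =
      ∫ p, d p.1 p.2 ∂P.prod (volume.restrict (Ioc (0 : ℝ) 1)) := (integral_prod _ hd).symm
  have hh_int : ∀ i, Integrable (fun p : (I × ℕ → ℝ) × ℝ => lam i * h i p.1 p.2)
      (P.prod (volume.restrict (Ioc (0 : ℝ) 1))) := fun i => (hint i).const_mul (lam i)
  have hdrift : ∫ p, (d p.1 p.2 + ∑ i, lam i * h i p.1 p.2)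
        ∂P.prod (volume.restrict (Ioc (0 : ℝ) 1)) =
      ∫ p, d p.1 p.2 ∂P.prod (volume.restrict (Ioc (0 : ℝ) 1)) +
        ∑ i, lam i * ∫ p, h i p.1 p.2 ∂P.prod (volume.restrict (Ioc (0 : ℝ) 1)) := by
    rw [integral_add (f := fun p => d p.1 p.2) hd (integrable_finsetSum _ fun i _ => hh_int i),
      integral_finsetSum _ fun i _ => hh_int i]
    simp only [integral_const_mul]
  rw [integral_add (g := fun g => ∑ i, arrivalSum (h i g) g i + ∫ t in Ioc (0 : ℝ) 1, d g t)
    (integrable_const c) (hsum_int.add hd_int), integral_const, probReal_univ, one_smul,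
    integral_add hsum_int hd_int, integral_finsetSum _ fun i _ => (hcampbell i).1, hd_prod, hdrift]
  simp only [(hcampbell _).2]
  rw [add_comm (∑ i, _)]

variable [MeasurableSpace Q] [MeasurableSingletonClass Q]

lemma IsGapLaw.dynkin_formula (hP : IsGapLaw lam P) {K : I → ℝ → Q → Q}
    (hK : ∀ i q, Measurable fun t => K i t q) (q₀ : Q) {F F' : ℝ → Q → ℝ}
    (hF : ∀ t q, HasDerivAt (fun t => F t q) (F' t q) t)
    (hF' : ∀ q, Continuous fun t => F' t q) :
    ∫ g, F 1 (runList (fun a => K a.1) (arrTime g) q₀ (arrivalOrder (arrTime g))) ∂P =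
      F 0 q₀ + ∫ p, (F' p.2 (stateBefore K q₀ p.1 p.2) +
        ∑ i, lam i * (F p.2 (K i p.2 (stateBefore K q₀ p.1 p.2)) -
          F p.2 (stateBefore K q₀ p.1 p.2))) ∂P.prod (volume.restrict (Ioc (0 : ℝ) 1)) := by
  have := hP.prob
  have hFcont : ∀ q, Continuous fun t => F t q := fun q =>
    continuous_iff_continuousAt.2 fun t => (hF t q).continuousAt
  obtain ⟨C, hC⟩ := exists_abs_le_on_Icc hFcont
  obtain ⟨D, hD⟩ := exists_abs_le_on_Icc hF'
  have hstate : Measurable fun p : (I × ℕ → ℝ) × ℝ => (p.2, stateBefore K q₀ p.1 p.2) :=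
    measurable_snd.prodMk (measurable_stateBefore hK q₀)
  have hFmeas : Measurable fun p : ℝ × Q => F p.1 p.2 :=
    measurable_from_prod_countable_left fun q => (hFcont q).measurable
  have hF'meas : Measurable fun p : ℝ × Q => F' p.1 p.2 :=
    measurable_from_prod_countable_left fun q => (hF' q).measurable
  have hKmeas : ∀ i, Measurable fun p : ℝ × Q => K i p.1 p.2 := fun i =>
    measurable_from_prod_countable_left (hK i)
  have hjump_meas : ∀ i, Measurable (Function.uncurry fun g t =>
      F t (K i t (stateBefore K q₀ g t)) - F t (stateBefore K q₀ g t)) := fun i =>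
    ((hFmeas.comp (measurable_fst.prodMk (hKmeas i))).sub hFmeas).comp hstate
  rw [← hP.integral_sum_arrivalSum_add hjump_meas
    (fun i => integrable_uncurry_of_bdd (hjump_meas i) fun g t ht =>
      (abs_sub _ _).trans (add_le_add (hC t ht _) (hC t ht _)))
    (fun i => (isPredictable_stateBefore K q₀).comp fun t q => F t (K i t q) - F t q)
    (integrable_uncurry_of_bdd (h := fun g t => F' t (stateBefore K q₀ g t))
      (hF'meas.comp hstate) fun g t ht => hD t ht _)]
  refine integral_congr_ae ?_
  filter_upwards [hP.ae_pos, hP.ae_injective, hP.ae_finite] with g hpos hinj hfin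
  exact apply_terminal_eq hpos (isOrdering_arrivalOrder hinj (finite_arrTime_le_one hfin))
    K q₀ hF hF'

lemma IsGapLaw.le_integral_of_drift_nonneg (hP : IsGapLaw lam P) {K : I → ℝ → Q → Q}
    (hK : ∀ i q, Measurable fun t => K i t q) (q₀ : Q) {F F' : ℝ → Q → ℝ}
    (hF : ∀ t q, HasDerivAt (fun t => F t q) (F' t q) t) (hF' : ∀ q, Continuous fun t => F' t q)
    (hdrift : ∀ t ∈ Icc (0 : ℝ) 1, ∀ q, 0 ≤ F' t q + ∑ i, lam i * (F t (K i t q) - F t q)) :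
    F 0 q₀ ≤
      ∫ g, F 1 (runList (fun a => K a.1) (arrTime g) q₀ (arrivalOrder (arrTime g))) ∂P := by
  rw [hP.dynkin_formula hK q₀ hF hF']
  refine le_add_of_nonneg_right (integral_nonneg_of_ae ?_)
  filter_upwards [Measure.quasiMeasurePreserving_snd.ae (ae_restrict_mem measurableSet_Ioc)]
    with p hp
  exact hdrift p.2 (Ioc_subset_Icc_self hp) _

end Drift

/-! ### The objective of Regularized Greedy -/

section Greedy

/-- For each offline vertex, the type of the heaviest edge matched to it. Unlike the vector of
weights `W : J → ℝ`, this state ranges over a finite type. -/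
@[ext]
structure MatchState (I J : Type*) where
  heaviest : J → Option I

instance {I J : Type*} [Finite I] [Finite J] : Finite (MatchState I J) :=
  .of_injective MatchState.heaviest fun _ _ => MatchState.ext

instance {I J : Type*} : MeasurableSpace (MatchState I J) := ⊤

instance {I J : Type*} : DiscreteMeasurableSpace (MatchState I J) := ⟨fun _ => trivial⟩

variable {I J : Type*}

/-- The vector of weights `w_j(t)` encoded by a state. Weights of pairs outside the type graph
may be negative and are cut off at `0`. -/
def MatchState.val (G : MatchingInstance I J) (q : MatchState I J) (j : J) : ℝ :=
  (q.heaviest j).elim 0 fun i => max (G.w i j) 0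

lemma MatchState.val_nonneg (G : MatchingInstance I J) (q : MatchState I J) (j : J) :
    0 ≤ q.val G j := by
  unfold MatchState.val
  rcases q.heaviest j with _ | i
  exacts [le_rfl, le_max_right _ _]

/-- The state in which no offline vertex is matched. -/
def MatchState.empty : MatchState I J := ⟨fun _ => none⟩

variable [DecidableEq J]

/-- The state after an online vertex of type `i` is matched according to `o`. -/
def MatchState.next (G : MatchingInstance I J) (q : MatchState I J) (i : I) :
    Option J → MatchState I J
  | none => q
  | some j => if q.val G j < G.w i j then ⟨Function.update q.heaviest j (some i)⟩ else q

lemma MatchState.val_next (G : MatchingInstance I J) (q : MatchState I J) (i : I) (o : Option J) :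
    (q.next G i o).val G = nextState G (q.val G) i o := by
  rcases o with _ | j
  · rfl
  rw [next, nextState]
  by_cases hlt : q.val G j < G.w i j
  · rw [if_pos hlt, max_eq_right hlt.le]
    ext k
    rcases eq_or_ne k j with rfl | hk
    · simp only [MatchState.val, Function.update_self]
      exact max_eq_left ((q.val_nonneg G k).trans hlt.le)
    · simp only [MatchState.val, Function.update_of_ne hk]
  · rw [if_neg hlt, max_eq_left (not_lt.1 hlt), Function.update_eq_self]

open Classical in
/-- The transitions of a decision rule on states. Outside the unit interval, where the rule need
not be measurable in time, the online vertex is left unmatched. -/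
def transition (G : MatchingInstance I J) (rule : I → ℝ → (J → ℝ) → Option J) (i : I) (t : ℝ)
    (q : MatchState I J) : MatchState I J :=
  q.next G i (if t ∈ Icc (0 : ℝ) 1 then rule i t (q.val G) else none)

variable {G : MatchingInstance I J} {x : I → J → ℝ} {rule : I → ℝ → (J → ℝ) → Option J}

lemma val_transition {t : ℝ} (ht : t ∈ Icc (0 : ℝ) 1) (i : I) (q : MatchState I J) :
    (transition G rule i t q).val G = nextState G (q.val G) i (rule i t (q.val G)) := by
  rw [transition, if_pos ht, MatchState.val_next]

lemma foldl_step_eq (τ : I × ℕ → ℝ) (l : List (I × ℕ)) (hl : ∀ a ∈ l, τ a ∈ Icc (0 : ℝ) 1)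
    (q : MatchState I J) :
    l.foldl (step G rule τ) (q.val G) =
      (runList (fun a => transition G rule a.1) τ q l).val G := by
  induction l generalizing q with
  | nil => rfl
  | cons a l ih =>
    have hstep : step G rule τ (q.val G) a = (transition G rule a.1 (τ a) q).val G := by
      rw [val_transition (hl a List.mem_cons_self)]
      unfold step nextState
      rcases rule a.1 (τ a) (q.val G) with _ | j <;> rfl
    rw [List.foldl_cons, hstep, ih (fun b hb => hl b (List.mem_cons_of_mem _ hb))]
    rfl

variable [Fintype J]

lemma algValue_eq_sum_val {τ : I × ℕ → ℝ} (hτ : ∀ a ∈ arrivalOrder τ, τ a ∈ Icc (0 : ℝ) 1) :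
    algValue G rule τ =
      ∑ j, (runList (fun a => transition G rule a.1) τ .empty (arrivalOrder τ)).val G j :=
  congrArg (fun W : J → ℝ => ∑ j, W j) (foldl_step_eq τ (arrivalOrder τ) hτ .empty)

variable [Fintype I] [DecidableEq I]

lemma measurable_transition (hrule : IsRegularizedGreedy G x rule) (i : I) (q : MatchState I J) :
    Measurable fun t => transition G rule i t q := by
  classical
  have hmatch : ∀ o, MeasurableSet
      {t | (if t ∈ Icc (0 : ℝ) 1 then rule i t (q.val G) else none) = o} := by
    intro o
    have hset : {t | (if t ∈ Icc (0 : ℝ) 1 then rule i t (q.val G) else none) = o} =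
        {t ∈ Icc (0 : ℝ) 1 | rule i t (q.val G) = o} ∪ ((Icc (0 : ℝ) 1)ᶜ ∩ {_t | none = o}) := by
      ext t
      by_cases ht : t ∈ Icc (0 : ℝ) 1 
      · simp only [mem_ofPred_eq, mem_union, mem_inter_iff, mem_compl_iff, ht, if_true,
          not_true_eq_false, false_and, or_false, true_and]
      · simp only [mem_ofPred_eq, mem_union, mem_inter_iff, mem_compl_iff, ht, if_false,
          not_false_eq_true, false_and, false_or, true_and]
    rw [hset]
    exact (hrule.meas i _ o).union (measurableSet_Icc.compl.inter (.const _))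
  refine measurable_to_countable' fun q' => ?_
  have hpre : (fun t => transition G rule i t q) ⁻¹' {q'} = ⋃ o ∈ {o | q.next G i o = q'},
      {t | (if t ∈ Icc (0 : ℝ) 1 then rule i t (q.val G) else none) = o} := by
    ext t
    simp [transition]
  rw [hpre]
  exact .biUnion (to_countable _) fun o _ => hmatch o

variable {P : Measure (I × ℕ → ℝ)}

lemma IsGapLaw.ae_algValue_eq (hP : IsGapLaw G.rate P) :
    (fun g => algValue G rule (arrTime g)) =ᵐ[P] fun g => potential G x 1
      ((runList (fun a => transition G rule a.1) (arrTime g) .empty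
        (arrivalOrder (arrTime g))).val G) := by
  filter_upwards [hP.ae_pos, hP.ae_injective, hP.ae_finite] with g hpos hinj hfin
  have hord := isOrdering_arrivalOrder hinj (finite_arrTime_le_one hfin)
  rw [potential_one]
  exact algValue_eq_sum_val fun a ha => ⟨(arrTime_pos hpos a).le, (hord.2 a).1 ha⟩

lemma IsGapLaw.integrable_algValue (hP : IsGapLaw G.rate P)
    (hrule : IsRegularizedGreedy G x rule) :
    Integrable (fun g => algValue G rule (arrTime g)) P :=
  (hP.integrable_terminal (measurable_transition hrule) .empty
    fun q => potential G x 1 (q.val G)).congr hP.ae_algValue_eq.symm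

lemma IsGapLaw.potential_le_integral_algValue (hP : IsGapLaw G.rate P)
    (hx : NaturalLPFeasible G x) (hrule : IsRegularizedGreedy G x rule) :
    potential G x 0 (fun _ => 0) ≤ ∫ g, algValue G rule (arrTime g) ∂P := by
  rw [integral_congr_ae hP.ae_algValue_eq]
  refine hP.le_integral_of_drift_nonneg (measurable_transition hrule) .empty
    (F := fun t q => potential G x t (q.val G)) (F' := fun t q => potentialDeriv G x t (q.val G))
    (fun t q => hasDerivAt_potential t _) (fun q => continuous_potentialDeriv _)
    fun t ht q => ?_
  simp only [val_transition ht]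
  exact potential_drift_nonneg hx hrule ht (q.val_nonneg G)

end Greedy

/-! ### The hindsight optimum -/

section Arrivals

variable {I : Type*}

lemma arrTime_le_one_of_mem_arrivals {τ : I × ℕ → ℝ} {a : I × ℕ} (ha : a ∈ arrivals τ) :
    τ a ≤ 1 := by
  by_cases hfin : {a | τ a ≤ 1}.Finite
  · exact (mem_arrivals hfin a).1 ha
  · simp [arrivals, hfin] at ha

lemma arrivals_eq_iff {τ : I × ℕ → ℝ} {s : Finset (I × ℕ)} :
    arrivals τ = s ↔ (∀ a, a ∈ s ↔ τ a ≤ 1) ∨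
      (¬∃ s' : Finset (I × ℕ), ∀ a, a ∈ s' ↔ τ a ≤ 1) ∧ ∅ = s := by
  by_cases hfin : {a | τ a ≤ 1}.Finite
  · have hex : ∃ s' : Finset (I × ℕ), ∀ a, a ∈ s' ↔ τ a ≤ 1 := ⟨arrivals τ, mem_arrivals hfin⟩
    simp only [hex, not_true_eq_false, false_and, or_false, Finset.ext_iff, mem_arrivals hfin]
    exact forall_congr' fun a => Iff.comm
  · have hnone : ∀ s' : Finset (I × ℕ), ¬∀ a, a ∈ s' ↔ τ a ≤ 1 := fun s' hs' =>
      hfin (s'.finite_toSet.subset fun a ha => (hs' a).2 ha)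
    simp only [hnone, exists_false, not_false_eq_true, true_and, false_or, arrivals, hfin,
      dite_false]

open scoped ENNReal in
lemma card_filter_arrivals_le_tsum [DecidableEq I] {g : I × ℕ → ℝ} (hg : ∀ a, 0 < g a) (i : I) :
    (((arrivals (arrTime g)).filter fun a => a.1 = i).card : ℝ≥0∞) ≤
      ∑' k, (Ioc (0 : ℝ) 1).indicator (fun _ => 1) (arrTime g (i, k)) := by
  set s := (arrivals (arrTime g)).filter fun a => a.1 = i
  have hinj : InjOn Prod.snd (s : Set (I × ℕ)) := fun a ha b hb hab =>
    Prod.ext ((Finset.mem_filter.1 ha).2.trans (Finset.mem_filter.1 hb).2.symm) hab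
  have hone : ∀ k ∈ s.image Prod.snd,
      (Ioc (0 : ℝ) 1).indicator (fun _ => (1 : ℝ≥0∞)) (arrTime g (i, k)) = 1 := by
    intro k hk
    obtain ⟨a, ha, rfl⟩ := Finset.mem_image.1 hk
    obtain ⟨hmem, rfl⟩ := Finset.mem_filter.1 ha
    exact indicator_of_mem (mem_Ioc.2 ⟨arrTime_pos hg _, arrTime_le_one_of_mem_arrivals hmem⟩) _
  calc (s.card : ℝ≥0∞)
      = ∑ k ∈ s.image Prod.snd, (Ioc (0 : ℝ) 1).indicator (fun _ => 1) (arrTime g (i, k)) := by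
        rw [Finset.sum_congr rfl hone, Finset.sum_const, Finset.card_image_of_injOn hinj, nsmul_one]
    _ ≤ _ := ENNReal.sum_le_tsum _

variable [Countable I]

lemma measurableSet_comp_arrivals (p : Finset (I × ℕ) → Prop) :
    MeasurableSet {g : I × ℕ → ℝ | p (arrivals (arrTime g))} := by
  have hmem : ∀ s : Finset (I × ℕ), Measurable fun g : I × ℕ → ℝ =>
      ∀ a, a ∈ s ↔ arrTime g a ≤ 1 := fun s => .forall fun a => measurable_const.iff
    (measurableSet_setOfPred.1 (measurableSet_le (measurable_arrTime a) measurable_const))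
  have heq : ∀ s, MeasurableSet {g : I × ℕ → ℝ | arrivals (arrTime g) = s} := fun s => by
    simp only [arrivals_eq_iff]
    exact measurableSet_setOfPred.2 ((hmem s).or ((Measurable.exists hmem).not.and
      measurable_const))
  have hset : {g : I × ℕ → ℝ | p (arrivals (arrTime g))} =
      ⋃ s ∈ {s | p s}, {g | arrivals (arrTime g) = s} := by
    ext g
    simp
  rw [hset]
  exact .biUnion (to_countable _) fun s _ => heq s

lemma measurable_comp_arrivals {β : Type*} [MeasurableSpace β] (f : Finset (I × ℕ) → β) :
    Measurable fun g : I × ℕ → ℝ => f (arrivals (arrTime g)) :=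
  fun B _ => measurableSet_comp_arrivals fun s => f s ∈ B

end Arrivals

section FirstArrivals

variable {I : Type*} [DecidableEq I] {lam : I → ℝ} {P : Measure (I × ℕ → ℝ)}

lemma IsGapLaw.measure_pi (hP : IsGapLaw lam P) (s : Finset (I × ℕ)) {t : I × ℕ → Set ℝ}
    (ht : ∀ a, MeasurableSet (t a)) :
    P ((s : Set (I × ℕ)).pi t) = ∏ a ∈ s, expMeasure (lam a.1) (t a) := by
  have := hP.prob
  induction s using Finset.induction_on with
  | empty => simp
  | insert a s ha ih =>
    have := isProbabilityMeasure_expMeasure (hP.pos a.1)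
    calc P (((insert a s : Finset (I × ℕ)) : Set (I × ℕ)).pi t)
        = (P.prod (expMeasure (lam a.1))) ((fun p => Function.update p.1 a p.2) ⁻¹'
            ((insert a s : Finset (I × ℕ)) : Set (I × ℕ)).pi t) := by
          rw [← Measure.map_apply measurable_update'
            (.pi (Finset.countable_toSet _) fun a _ => ht a), hP.resample]
      _ = _ := by
          rw [preimage_update_pi (Finset.mem_insert_self a s), Measure.prod_prod,
            Finset.erase_insert ha, ih, Finset.prod_insert ha, mul_comm]

lemma IsGapLaw.measureReal_forall_lt (hP : IsGapLaw lam P) (S : Finset I) :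
    P.real {g | ∀ i ∈ S, 1 < g (i, 0)} = Real.exp (-∑ i ∈ S, lam i) := by
  have hset : {g : I × ℕ → ℝ | ∀ i ∈ S, 1 < g (i, 0)} =
      ((S.map (.sectL I 0) : Finset (I × ℕ)) : Set (I × ℕ)).pi fun _ => Ioi 1 := by
    ext g
    simp
  rw [Measure.real, hset, hP.measure_pi _ fun _ => measurableSet_Ioi, Finset.prod_map,
    ENNReal.toReal_prod, ← Finset.sum_neg_distrib, Real.exp_sum]
  refine Finset.prod_congr rfl fun i _ => ?_
  simp [expMeasure_Ioi (hP.pos i) zero_le_one, (Real.exp_pos _).le]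

end FirstArrivals

section Values

variable {I J : Type*} [Fintype J] [DecidableEq J] {G : MatchingInstance I J}

lemma assignmentValue_nonneg (τ : I × ℕ → ℝ) (m : I × ℕ → Option J) :
    0 ≤ assignmentValue G τ m :=
  Finset.sum_nonneg fun _ _ => (Finset.le_fold_max _).2 (.inl le_rfl)

lemma optValue_nonneg (τ : I × ℕ → ℝ) : 0 ≤ optValue G τ :=
  Real.iSup_nonneg fun m => assignmentValue_nonneg τ m.1

lemma measurable_optValue [Countable I] :
    Measurable fun g : I × ℕ → ℝ => optValue G (arrTime g) := by
  have hmeas := measurable_comp_arrivals (I := I) fun s =>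
    ⨆ m : {m : I × ℕ → Option J // ∀ a j, m a = some j → (a.1, j) ∈ G.E},
      ∑ j, (s.filter fun a => m.1 a = some j).fold max 0 fun a => G.w a.1 j
  exact hmeas

end Values

section Optimum

variable {I J : Type*} [DecidableEq I]

/-- The total weight of the edges `(i, j)` with `c j = some i`. -/
def choiceValue (G : MatchingInstance I J) (c : J → Option I) : ℝ :=
  ∑ e ∈ G.E, if c e.2 = some e.1 then G.w e.1 e.2 else 0

/-- The probability that the choice `c`, made as a function of the set of online vertices,
selects type `i` at the offline vertex `j`. -/
def choiceProb (P : Measure (I × ℕ → ℝ)) (c : Finset (I × ℕ) → J → Option I) (i : I) (j : J) : ℝ :=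
  P.real {g | c (arrivals (arrTime g)) j = some i}

lemma integral_choiceValue [Countable I] {P : Measure (I × ℕ → ℝ)} [IsFiniteMeasure P]
    (G : MatchingInstance I J) (c : Finset (I × ℕ) → J → Option I) :
    Integrable (fun g => choiceValue G (c (arrivals (arrTime g)))) P ∧
      ∫ g, choiceValue G (c (arrivals (arrTime g))) ∂P = naturalLPValue G (choiceProb P c) := by
  have hmeas : ∀ e : I × J,
      MeasurableSet {g : I × ℕ → ℝ | c (arrivals (arrTime g)) e.2 = some e.1} := fun e =>
    measurableSet_comp_arrivals fun s => c s e.2 = some e.1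
  have hite : ∀ e : I × J, (fun g : I × ℕ → ℝ =>
      if c (arrivals (arrTime g)) e.2 = some e.1 then G.w e.1 e.2 else 0) =
        {g | c (arrivals (arrTime g)) e.2 = some e.1}.indicator fun _ => G.w e.1 e.2 := fun e => by
    ext g
    simp only [indicator, mem_ofPred_eq]
  have hint : ∀ e ∈ G.E, Integrable (fun g : I × ℕ → ℝ =>
      if c (arrivals (arrTime g)) e.2 = some e.1 then G.w e.1 e.2 else 0) P := fun e _ => by
    rw [hite]
    exact (integrable_const (G.w e.1 e.2)).indicator (hmeas e)
  refine ⟨integrable_finsetSum _ hint, (integral_finsetSum _ hint).trans ?_⟩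
  refine Finset.sum_congr rfl fun e _ => ?_
  rw [hite, integral_indicator_const _ (hmeas e), smul_eq_mul, mul_comm, choiceProb]

variable [Fintype J]

/-- The choice `c` of at most one type for each offline vertex picks edges of the type graph, and
picks no type more often than it occurs among the online vertices `s`. -/
structure IsHeaviestChoice (G : MatchingInstance I J) (s : Finset (I × ℕ)) (c : J → Option I) :
    Prop where
  edge : ∀ i j, c j = some i → (i, j) ∈ G.E
  card : ∀ i, (Finset.univ.filter fun j => c j = some i).card ≤ (s.filter fun a => a.1 = i).card

variable {G : MatchingInstance I J} {s : Finset (I × ℕ)}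

lemma IsHeaviestChoice.exists_mem {c : J → Option I} (hc : IsHeaviestChoice G s c) {i : I} {j : J}
    (hij : c j = some i) : ∃ a ∈ s, a.1 = i := by
  have hpos : 0 < (Finset.univ.filter fun j => c j = some i).card :=
    Finset.card_pos.2 ⟨j, by simpa using hij⟩
  obtain ⟨a, ha⟩ := Finset.card_pos.1 (hpos.trans_le (hc.card i))
  exact ⟨a, Finset.mem_filter.1 ha⟩

lemma isHeaviestChoice_none : IsHeaviestChoice G s fun _ => none :=
  ⟨by simp, by simp⟩

lemma sum_elim_eq_choiceValue {c : J → Option I} (hc : ∀ i j, c j = some i → (i, j) ∈ G.E) :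
    ∑ j, (c j).elim 0 (fun i => G.w i j) = choiceValue G c := by
  classical
  rw [choiceValue, ← Finset.sum_fiberwise _ Prod.snd]
  refine Finset.sum_congr rfl fun j _ => ?_
  rcases hcj : c j with _ | i
  · refine (Finset.sum_eq_zero fun e he => if_neg ?_).symm
    simp [(Finset.mem_filter.1 he).2, hcj]
  · have hmem : (i, j) ∈ G.E.filter fun e => e.2 = j := Finset.mem_filter.2 ⟨hc i j hcj, rfl⟩
    rw [Finset.sum_eq_single_of_mem (i, j) hmem]
    · rw [if_pos hcj, Option.elim_some]
    · rintro ⟨i', j'⟩ he hne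
      obtain rfl : j' = j := (Finset.mem_filter.1 he).2
      exact if_neg fun hci' => hne (Prod.ext (Option.some.inj (hci'.symm.trans hcj)) rfl)

variable [DecidableEq J]

lemma exists_fold_max_eq {α : Type*} (t : Finset α) {f : α → ℝ} (hf : ∀ a ∈ t, 0 ≤ f a) :
    ∃ o : Option α, (∀ a, o = some a → a ∈ t) ∧ t.fold max 0 f = o.elim 0 f := by
  rcases t.eq_empty_or_nonempty with rfl | hne
  · exact ⟨none, by simp⟩
  · obtain ⟨a, ha, hmax⟩ := t.exists_max_image f hne
    exact ⟨some a, by simpa using ha, le_antisymm ((Finset.fold_max_le _).2 ⟨hf a ha, hmax⟩)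
      ((Finset.le_fold_max _).2 (.inr ⟨a, ha, le_rfl⟩))⟩

lemma exists_isHeaviestChoice (τ : I × ℕ → ℝ) {m : I × ℕ → Option J}
    (hm : ∀ a j, m a = some j → (a.1, j) ∈ G.E) :
    ∃ c, IsHeaviestChoice G (arrivals τ) c ∧ assignmentValue G τ m = choiceValue G c := by
  choose o hmem hfold using fun j => exists_fold_max_eq
    ((arrivals τ).filter fun a => m a = some j) (f := fun a => G.w a.1 j)
    fun a ha => (G.w_pos _ _ (hm a j (Finset.mem_filter.1 ha).2)).le
  have hmatched : ∀ a j, o j = some a → m a = some j := fun a j ha =>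
    (Finset.mem_filter.1 (hmem j a ha)).2
  have hedge : ∀ i j, (o j).map Prod.fst = some i → (i, j) ∈ G.E := by
    intro i j hij
    obtain ⟨a, ha, rfl⟩ := Option.map_eq_some_iff.1 hij
    exact hm a j (hmatched a j ha)
  refine ⟨fun j => (o j).map Prod.fst, ⟨hedge, fun i => ?_⟩, ?_⟩
  · refine Finset.card_le_card_of_forall_subsingleton (fun j a => o j = some a) (fun j hj => ?_)
      fun a _ j hj k hk => ?_
    · obtain ⟨a, ha, hai⟩ := Option.map_eq_some_iff.1 (Finset.mem_filter.1 hj).2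
      exact ⟨a, Finset.mem_filter.2 ⟨(Finset.mem_filter.1 (hmem j a ha)).1, hai⟩, ha⟩
    · exact Option.some.inj ((hmatched a j hj.2).symm.trans (hmatched a k hk.2))
  · rw [← sum_elim_eq_choiceValue hedge]
    refine Finset.sum_congr rfl fun j _ => (hfold j).trans ?_
    rcases o j with _ | a <;> rfl

lemma exists_bestChoice [Finite I] (G : MatchingInstance I J) :
    ∃ c : Finset (I × ℕ) → J → Option I, (∀ s, IsHeaviestChoice G s (c s)) ∧
      ∀ τ, optValue G τ ≤ choiceValue G (c (arrivals τ)) := by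
  choose c hc hmax using fun s : Finset (I × ℕ) =>
    exists_max_image {c | IsHeaviestChoice G s c} (choiceValue G) (toFinite _)
      ⟨_, isHeaviestChoice_none⟩
  refine ⟨c, hc, fun τ => Real.iSup_le (fun m => ?_) ?_⟩
  · obtain ⟨c', hc', heq⟩ := exists_isHeaviestChoice τ m.2
    exact heq.trans_le (hmax _ _ hc')
  · refine Finset.sum_nonneg fun e he => ?_
    split_ifs
    exacts [(G.w_pos _ _ he).le, le_rfl]

end Optimum

section ChoiceProbabilities

variable {I J : Type*} [DecidableEq I] [Fintype J]
  {G : MatchingInstance I J} {lam : I → ℝ} {P : Measure (I × ℕ → ℝ)}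
  {c : Finset (I × ℕ) → J → Option I}

lemma IsGapLaw.sum_choiceProb_le [Countable I] (hP : IsGapLaw lam P)
    (hc : ∀ s, IsHeaviestChoice G s (c s)) (i : I) : ∑ j, choiceProb P c i j ≤ lam i := by
  have := hP.prob
  have hmeas : ∀ j, MeasurableSet {g : I × ℕ → ℝ | c (arrivals (arrTime g)) j = some i} :=
    fun j => measurableSet_comp_arrivals fun s => c s j = some i
  refine (ENNReal.ofReal_le_ofReal_iff (hP.pos i).le).1 ?_
  calc ENNReal.ofReal (∑ j, choiceProb P c i j)
      = ∑ j, P {g | c (arrivals (arrTime g)) j = some i} := by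
        simp only [choiceProb]
        rw [ENNReal.ofReal_sum_of_nonneg fun j _ => measureReal_nonneg]
        exact Finset.sum_congr rfl fun j _ => ofReal_measureReal
    _ = ∫⁻ g, ((Finset.univ.filter fun j => c (arrivals (arrTime g)) j = some i).card : ENNReal)
          ∂P := by
        simp only [← lintegral_indicator_one (hmeas _)]
        rw [← lintegral_finsetSum _ fun j _ => measurable_one.indicator (hmeas j)]
        exact lintegral_congr fun g => by simp [indicator]
    _ ≤ ∫⁻ g, ∑' k, (Ioc (0 : ℝ) 1).indicator (fun _ => 1) (arrTime g (i, k)) ∂P := by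
        refine lintegral_mono_ae (hP.ae_pos.mono fun g hpos => ?_)
        exact (Nat.cast_le.2 ((hc _).card i)).trans (card_filter_arrivals_le_tsum hpos i)
    _ ≤ ENNReal.ofReal (lam i) := hP.lintegral_count_le i

lemma IsGapLaw.sum_choiceProb_le_one_sub_exp [Countable I] (hP : IsGapLaw lam P)
    (hc : ∀ s, IsHeaviestChoice G s (c s)) (j : J) (S : Finset I) :
    ∑ i ∈ S, choiceProb P c i j ≤ 1 - Real.exp (-∑ i ∈ S, lam i) := by
  have := hP.prob
  have hmeas : MeasurableSet {g : I × ℕ → ℝ | ∀ i ∈ S, 1 < g (i, 0)} :=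
    measurableSet_setOfPred.2 (.forall fun i => .imp measurable_const (measurableSet_setOfPred.1
      (measurableSet_lt measurable_const (measurable_pi_apply (i, 0)))))
  have hdisj : (S : Set I).PairwiseDisjoint
      fun i => {g : I × ℕ → ℝ | c (arrivals (arrTime g)) j = some i} :=
    fun i _ i' _ hne => disjoint_left.2 fun g hg hg' =>
      hne (Option.some.inj ((Eq.symm hg).trans hg'))
  simp only [choiceProb]
  rw [← measureReal_biUnion_finset hdisj fun i _ =>
      measurableSet_comp_arrivals fun s => c s j = some i,
    ← hP.measureReal_forall_lt, ← probReal_compl_eq_one_sub hmeas]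
  refine ENNReal.toReal_mono (measure_ne_top _ _) (measure_mono_ae ?_)
  filter_upwards [hP.ae_pos] with g hpos hg hnone
  obtain ⟨i, hi, hgi⟩ := mem_iUnion₂.1 hg
  obtain ⟨a, ha, rfl⟩ := (hc _).exists_mem hgi
  have hfirst : arrTime g (a.1, 0) ≤ 1 :=
    ((strictMono_arrTime hpos a.1).monotone (Nat.zero_le a.2)).trans
      (arrTime_le_one_of_mem_arrivals ha)
  exact (hnone a.1 hi).not_ge (by simpa [arrTime] using hfirst)

variable [DecidableEq J]

lemma IsGapLaw.naturalLPFeasible_choiceProb [Fintype I] (hP : IsGapLaw G.rate P)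
    (hc : ∀ s, IsHeaviestChoice G s (c s)) : NaturalLPFeasible G (choiceProb P c) where
  nonneg _ _ _ := measureReal_nonneg
  online i := (Finset.sum_le_univ_sum_of_nonneg fun _ => measureReal_nonneg).trans
    (hP.sum_choiceProb_le hc i)
  offline j S _ := hP.sum_choiceProb_le_one_sub_exp hc j S

lemma IsGapLaw.integrable_optValue [Finite I] (hP : IsGapLaw lam P) :
    Integrable (fun g => optValue G (arrTime g)) P := by
  have := hP.prob
  obtain ⟨c, -, hopt⟩ := exists_bestChoice G
  refine (integral_choiceValue G c).1.mono' measurable_optValue.aestronglyMeasurable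
    (.of_forall fun g => ?_)
  rw [Real.norm_of_nonneg (optValue_nonneg _)]
  exact hopt _

lemma IsGapLaw.integral_optValue_le [Fintype I] (hP : IsGapLaw G.rate P) {x : I → J → ℝ}
    (hx : NaturalLPOptimal G x) : ∫ g, optValue G (arrTime g) ∂P ≤ naturalLPValue G x := by
  have := hP.prob
  obtain ⟨c, hc, hopt⟩ := exists_bestChoice G
  obtain ⟨hint, hvalue⟩ := integral_choiceValue (P := P) G c
  calc ∫ g, optValue G (arrTime g) ∂P
      ≤ ∫ g, choiceValue G (c (arrivals (arrTime g))) ∂P :=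
        integral_mono hP.integrable_optValue hint fun g => hopt _
    _ = naturalLPValue G (choiceProb P c) := hvalue
    _ ≤ naturalLPValue G x := hx.2 _ (hP.naturalLPFeasible_choiceProb hc)

end ChoiceProbabilities

end StochMatching

end

theorem mainTheorem4 {I J Ω : Type*} [Fintype I] [DecidableEq I] [Fintype J] [DecidableEq J]
    [MeasurableSpace Ω] (μ : Measure Ω) [IsProbabilityMeasure μ]
    (G : StochMatching.MatchingInstance I J)
    (gap : I → ℕ → Ω → ℝ) (hgap : StochMatching.IsPoissonArrivals μ G.rate gap)
    (x : I → J → ℝ) (hx : StochMatching.NaturalLPOptimal G x)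
    (rule : I → ℝ → (J → ℝ) → Option J) (hrule : StochMatching.IsRegularizedGreedy G x rule) :
    Integrable (fun ω => StochMatching.algValue G rule (StochMatching.arrivalTime gap ω)) μ ∧
    Integrable (fun ω => StochMatching.optValue G (StochMatching.arrivalTime gap ω)) μ ∧
    0.706 * ∫ ω, StochMatching.optValue G (StochMatching.arrivalTime gap ω) ∂μ ≤
      ∫ ω, StochMatching.algValue G rule (StochMatching.arrivalTime gap ω) ∂μ := by
  have hP := hgap.isGapLaw G.rate_pos
  have hm : AEMeasurable (fun ω (a : I × ℕ) => gap a.1 a.2 ω) μ :=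
    (measurable_pi_iff.2 fun a : I × ℕ => hgap.meas a.1 a.2).aemeasurable
  have halg := hP.integrable_algValue hrule
  have hopt := hP.integrable_optValue (G := G)
  have hgreedy := hP.potential_le_integral_algValue hx.1 hrule
  have hlp := hP.integral_optValue_le hx
  rw [integral_map hm halg.aestronglyMeasurable] at hgreedy
  rw [integral_map hm hopt.aestronglyMeasurable] at hlp
  refine ⟨halg.comp_aemeasurable hm, hopt.comp_aemeasurable hm, ?_⟩
  exact (mul_le_mul_of_nonneg_left hlp (by norm_num)).trans
    ((StochMatching.le_potential_zero hx.1).trans hgreedy)
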